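/- Theorem 1. Fix integers $k\ge 1$, $\eta_1\ge 1$, $\eta_2\ge 0$. For $n\ge 1$ let $R=\mathbb{Z}[X]/(X^n+1)$, identify elements of $R$ with their coefficient vectors, and consider $$n_e=\mathbf e^{T}\mathbf r+e_2+c_v-\mathbf s^{T}(\mathbf e_1+\mathbf c_u)\in R\cong\mathbb{Z}^n\subset\mathbb{R}^n,$$ where $\mathbf e,\mathbf r,\mathbf s,\mathbf e_1,\mathbf c_u\in R^k$ and $e_2,c_v\in R$ have mutually independent coefficients: those of $\mathbf e,\mathbf r,\mathbf s$ have the central binomial law $\beta_{\eta_1}$, where $\beta_\eta=B(2\eta,1/2)-\eta$; those of $\mathbf e_1,e_2$ have law $\beta_{\eta_2}$; those of $\mathbf c_u$ have a law $\psi$ on $\mathbb{Z}$; and those of $c_v$ are uniform on the integers in $[-b,b]$, $b=\lceil q/2^{d_v+1}\rfloor$ (nearest integer, ties upwards). Put $$\sigma_G^2=\frac{kn\eta_1^2}{4}+\frac{kn\eta_1}{2}\Big(\frac{\eta_2}{2}+\mathrm{Var}(\psi)\Big)+\frac{\eta_2}{2}.$$ For a covariance matrix $\Sigma_n$ let $Q_n$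 be the law of the sum of independent random vectors with laws $\mathcal N(0,\Sigma_n)$ and $\mathcal U(-b,b)^{n}$ ($n$ i.i.d. coordinates). We say that $n_e$ asymptotically follows $\mathcal N(0,\Sigma_n)+\mathcal U(-b,b)$ if (i) for every $n$ the law of $n_e$ and $Q_n$ have finite second moments, the same mean vector and the same $n\times n$ covariance matrix; and (ii) for every $\ell$ and $\varepsilon>0$ there is $N$ such that for all $n\ge N$, all distinct $i_1,\dots,i_\ell$ and all Borel convex $A\subseteq\mathbb{R}^\ell$, $$\big|\Pr\big((n_{e,i_1},\dots,n_{e,i_\ell})\in A\big)-Q_n\big(x:(x_{i_1},\dots,x_{i_\ell})\in A\big)\big|\le\varepsilon .$$ (a) Let $\psi$ be any law on $\mathbb{Z}$ with mean $0$ and finite variance. Then $n_e$ asymptotically follows $\mathcal N(0,\sigma_G^2 I_n)+\mathcal U(-b,b)$, i.e. (i) and (ii) hold with $\Sigma_n=\sigma_G^2I_n$, for all integers $q,d_v\ge 0$, and $N$ in (ii) does not depend on $q$ and $d_v$. (b) Let $q,d_u$ be integers with $d_u\ge 1$, $2^{d_u}<q$, and let $\psi=\psi_{d_u}$ be Kyber's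 exact rounding noise: the law of $y-\mathsf{Decompress}_q(\mathsf{Compress}_q(y,d_u),d_u)$, reduced modulo $q$ to $(-q/2,q/2]$, for $y$ uniform on $\{0,\dots,q-1\}$, where $\mathsf{Compress}_q(x,d)=\lceil (2^d/q)x\rfloor \bmod 2^d$ and $\mathsf{Decompress}_q(x,d)=\lceil (q/2^d)x\rfloor$. Let $m$ be its mean. Then (i) and (ii) hold with $$(\Sigma_n)_{ij}=\sigma_G^2\,\delta_{ij}+\frac{k\eta_1}{2}\,m^2\,(n-2|i-j|),$$ for all integers $d_v\ge 0$, and $N$ in (ii) does not depend on $d_v$. If $m=0$ this is $\sigma_G^2I_n$. (For $q=3329$, $d_u=10,11$ one has $m=-2/3329$ and $m=-1/3329$, so the correction is negligible in practice.) -/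

import Mathlib

open MeasureTheory ProbabilityTheory
open scoped BigOperators

namespace Kyber

/-! ### The ring `ℤ[X]/(X^n+1)` in coefficients -/

/-- The polynomial of degree `< n` with coefficient vector `a`. -/
noncomputable def toPoly {n : ℕ} (a : Fin n → ℤ) : Polynomial ℤ :=
  ∑ i, Polynomial.C (a i) * Polynomial.X ^ (i : ℕ)

/-- Multiplication in `ℤ[X]/(X^n+1)` on coefficient vectors:
`(a b)_i = ∑_j ξ(i-j) a_{(i-j) mod n} b_j`, with `ξ(i-j) = 1` for `j ≤ i` and `-1` otherwise
(the subtraction in `Fin n` is modulo `n`). -/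
def ringMul {n : ℕ} (a b : Fin n → ℤ) : Fin n → ℤ :=
  fun i => ∑ j, (if j ≤ i then 1 else -1) * (a (i - j) * b j)

/-- `ringMul` is the multiplication modulo `X^n+1`. -/
theorem dvd_toPoly_mul_sub {n : ℕ} (a b : Fin n → ℤ) :
    (Polynomial.X ^ n + 1 : Polynomial ℤ) ∣ toPoly a * toPoly b - toPoly (ringMul a b) := by
  rcases Nat.eq_zero_or_pos n with rfl | hn
  · simp [toPoly]
  have : NeZero n := ⟨hn.ne'⟩
  have key : ∀ i j : Fin n, (Polynomial.X ^ n + 1 : Polynomial ℤ) ∣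
      Polynomial.X ^ (((i - j : Fin n) : ℕ) + (j : ℕ))
        - Polynomial.C (if j ≤ i then 1 else -1) * Polynomial.X ^ (i : ℕ) := by
    intro i j
    by_cases h : j ≤ i
    · have h1 : ((i - j : Fin n) : ℕ) + (j : ℕ) = i := by
        rw [Fin.sub_val_of_le h]
        have : (j : ℕ) ≤ i := h
        omega
      simp [h, h1]
    · have h1 : ((i - j : Fin n) : ℕ) + (j : ℕ) = i + n := by
        have h2 : (i : ℕ) < j := by simpa using h
        have hj := j.isLt
        rw [Fin.sub_def]
        simp only
        rw [Nat.mod_eq_of_lt (by omega)]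
        omega
      refine ⟨Polynomial.X ^ (i : ℕ), ?_⟩
      simp only [h, h1, if_false, map_neg, map_one]
      ring
  have hsum : toPoly a * toPoly b - toPoly (ringMul a b)
      = ∑ j : Fin n, ∑ i : Fin n, Polynomial.C (a (i - j) * b j) *
        (Polynomial.X ^ (((i - j : Fin n) : ℕ) + (j : ℕ))
          - Polynomial.C (if j ≤ i then 1 else -1) * Polynomial.X ^ (i : ℕ)) := by
    have e1 : toPoly a * toPoly b = ∑ j : Fin n, ∑ i : Fin n, Polynomial.C (a (i - j) * b j) *
        Polynomial.X ^ (((i - j : Fin n) : ℕ) + (j : ℕ)) := by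
      rw [toPoly, toPoly, Finset.sum_mul_sum, Finset.sum_comm]
      refine Finset.sum_congr rfl fun j _ => ?_
      rw [← Equiv.sum_comp (Equiv.subRight j)]
      refine Finset.sum_congr rfl fun i _ => ?_
      simp only [Equiv.subRight_apply, map_mul, pow_add]
      ring
    have e2 : toPoly (ringMul a b) = ∑ j : Fin n, ∑ i : Fin n, Polynomial.C (a (i - j) * b j) *
        (Polynomial.C (if j ≤ i then 1 else -1) * Polynomial.X ^ (i : ℕ)) := by
      rw [Finset.sum_comm]
      refine Finset.sum_congr rfl fun i _ => ?_
      rw [ringMul, map_sum, Finset.sum_mul]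
      refine Finset.sum_congr rfl fun j _ => ?_
      simp only [map_mul]
      ring
    rw [e1, e2, ← Finset.sum_sub_distrib]
    refine Finset.sum_congr rfl fun j _ => ?_
    rw [← Finset.sum_sub_distrib]
    exact Finset.sum_congr rfl fun i _ => by ring
  rw [hsum]
  exact Finset.dvd_sum fun j _ => Finset.dvd_sum fun i _ => Dvd.dvd.mul_left (key i j) _

/-- `uᵀ v` for vectors `u, v` of `k` ring elements. -/
def ringDot {k n : ℕ} (u v : Fin k → Fin n → ℤ) : Fin n → ℤ := ∑ t, ringMul (u t) (v t)

/-- The decoding noise `n_e = eᵀ r + e₂ + c_v - sᵀ (e₁ + c_u)`. -/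
def decodingNoise {k n : ℕ} (e r s e₁ cu : Fin k → Fin n → ℤ) (e₂ cv : Fin n → ℤ) : Fin n → ℤ :=
  ringDot e r + e₂ + cv - ringDot s (e₁ + cu)

/-! ### The distributions -/

/-- The central binomial distribution `β_η = B(2η, 1/2) - η` on `ℤ`. -/
noncomputable def centralBinomial (η : ℕ) : Measure ℤ :=
  (binomial (2 * η) ⟨1 / 2, by norm_num, by norm_num⟩).map (fun j : ℕ => (j : ℤ) - (η : ℤ))

/-- The discrete uniform distribution `U(-b, b)` on the integers from `-b` to `b`. -/
noncomputable def discreteUniform (b : ℤ) : Measure ℤ := uniformOn (Set.Icc (-b) b)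

/-- `⌈q/2^(d+1)⌋`, rounded to the nearest integer, ties upwards. -/
def halfWidth (q d : ℕ) : ℤ := round ((q : ℚ) / 2 ^ (d + 1))

/-- `Compress_q(x, d) = ⌈(2^d/q) x⌋ mod 2^d`. -/
def compress (q d : ℕ) (x : ℤ) : ℤ := round ((2 : ℚ) ^ d / q * x) % 2 ^ d

/-- `Decompress_q(x, d) = ⌈(q/2^d) x⌋`. -/
def decompress (q d : ℕ) (x : ℤ) : ℤ := round ((q : ℚ) / 2 ^ d * x)

/-- Kyber's rounding noise `ψ_d` for the modulus `q`: the law of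
`y - Decompress_q(Compress_q(y, d), d)` reduced modulo `q` to `(-q/2, q/2]`, where `y` is uniform
on `{0, …, q-1}`. -/
noncomputable def roundingNoise (q d : ℕ) : Measure ℤ :=
  (uniformOn (Set.Ico (0 : ℤ) q)).map
    (fun y => ((y - decompress q d (compress q d y) : ℤ) : ZMod q).valMinAbs)

/-- The law of `k` ring elements whose `k n` coefficients are i.i.d. with law `μ`. -/
noncomputable def iidVec (k n : ℕ) (μ : Measure ℤ) : Measure (Fin k → Fin n → ℤ) :=
  Measure.pi fun _ => Measure.pi fun _ => μ

/-- The law (as a vector in `ℝⁿ`) of the decoding noise when `e, r, s ← β_{η₁}^k`, `e₁ ← β_{η₂}^k`,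
`c_u ← ψ^k`, `e₂ ← β_{η₂}`, `c_v ← U(-b, b)` are sampled coefficientwise, all independent. -/
noncomputable def noiseLaw (k η₁ η₂ : ℕ) (ψ : Measure ℤ) (b : ℤ) (n : ℕ) : Measure (Fin n → ℝ) :=
  ((iidVec k n (centralBinomial η₁)).prod
    ((iidVec k n (centralBinomial η₁)).prod
      ((iidVec k n (centralBinomial η₁)).prod
        ((iidVec k n (centralBinomial η₂)).prod
          ((iidVec k n ψ).prod
            ((Measure.pi fun _ : Fin n => centralBinomial η₂).prod
              (Measure.pi fun _ : Fin n => discreteUniform b))))))).map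
    fun (e, r, s, e₁, cu, e₂, cv) => fun i => (decodingNoise e r s e₁ cu e₂ cv i : ℝ)

/-- `σ_G² = k n η₁²/4 + k n η₁/2 (η₂/2 + Var ψ) + η₂/2`. -/
noncomputable def sigmaSq (k η₁ η₂ : ℕ) (ψ : Measure ℤ) (n : ℕ) : ℝ :=
  (k * n * η₁ ^ 2 : ℝ) / 4
    + (k * n * η₁ : ℝ) / 2 * ((η₂ : ℝ) / 2 + Var[fun c : ℤ => (c : ℝ); ψ]) + (η₂ : ℝ) / 2

/-- The matrix with entries `n - 2|i - j|`. -/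
def overlap (n : ℕ) : Matrix (Fin n) (Fin n) ℝ :=
  Matrix.of fun i j => (n : ℝ) - 2 * |((i : ℕ) : ℝ) - ((j : ℕ) : ℝ)|

/-- The law on `ℝⁿ` of `x + y` with independent `x ← N(0, S)` and `y` with i.i.d. coordinates
of law `U(-b, b)`. -/
noncomputable def gaussianPlusUniform {n : ℕ} (S : Matrix (Fin n) (Fin n) ℝ) (b : ℤ) :
    Measure (Fin n → ℝ) :=
  ((multivariateGaussian 0 S).map fun x => (fun i => x i)).conv
    (Measure.pi fun _ : Fin n => (discreteUniform b).map fun c : ℤ => (c : ℝ))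

/-! ### Comparison of laws on `ℝⁿ` -/

/-- `P` and `Q` have finite second moments, the same mean vector and the same covariance matrix. -/
def SameMeanCov {n : ℕ} (P Q : Measure (Fin n → ℝ)) : Prop :=
  (∀ i, MemLp (fun x : Fin n → ℝ => x i) 2 P ∧ MemLp (fun x : Fin n → ℝ => x i) 2 Q) ∧
  (∀ i, ∫ x, x i ∂P = ∫ x, x i ∂Q) ∧
  ∀ i j, covariance (fun x => x i) (fun x => x j) P = covariance (fun x => x i) (fun x => x j) Q

/-- For every choice of `ℓ` distinct coordinates, the joint laws of these coordinates under `P` and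
under `Q` differ by at most `ε` on every (Borel) convex subset of `ℝ^ℓ`. -/
def MarginalsClose {n : ℕ} (ℓ : ℕ) (ε : ℝ) (P Q : Measure (Fin n → ℝ)) : Prop :=
  ∀ (I : Fin ℓ ↪ Fin n) (A : Set (Fin ℓ → ℝ)), MeasurableSet A → Convex ℝ A →
    |P.real {x | (fun a => x (I a)) ∈ A} - Q.real {x | (fun a => x (I a)) ∈ A}| ≤ ε

end Kyber

/-! Apart from `c_v`, the noise is a sum of three independent pieces: the bilinear forms `eᵀr` and
`sᵀ(-(e₁ + c_u))`, and the vector `e₂`. Given `s`, a linear combination of `ℓ` coordinates of a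
bilinear form in `s` and `c` is a sum of independent terms `c_p` whose coefficients are signed
combinations of `ℓ` entries of `s` (`rowForm`). After scaling by `n^(-1/2)` it is conditionally
nearly Gaussian. Its conditional variance is governed by the sum of the squared coefficients, which
concentrates because two coefficients are dependent only if they share an entry of `s`. Its
conditional mean is the mean of `c_p` times the sum of the coefficients, which is again a linear
form in i.i.d. entries (`colForm`) and hence nearly Gaussian. This conditional mean produces the
overlap term of the covariance (`exists_norm_integral_rowForm_sub_le`).

The scaled covariance depends on `n` and on the chosen coordinates, so there is no single limit law.
The ratios `overlapRatio` stay in a compact set, however. Along a sequence of counterexamples a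
subsequence of them converges, and by Lévy's continuity theorem the noise and its Gaussian model
then tend to the same law. That law is absolutely continuous since `k` and `η₁` are positive.

Weak convergence to an absolutely continuous law is uniform over convex sets
(`eventually_forall_convex_abs_sub_le`). Lévy–Prokhorov closeness costs only the mass of a thin
layer at the boundary, and this mass is uniformly small because many translates of the points that
leave a convex set are disjoint and have almost equal mass.

Finally, `c_v` is independent of the rest and is added unscaled on both sides. Conditioning on it
only translates the convex set (`marginalsClose_conv`), so the bound holds for all widths `b` at
once. -/

namespace Kyber

/-! ### Small translations under absolutely continuous measures. -/

section Translate

variable {E : Type*} [NormedAddCommGroup E] [NormedSpace ℝ E] [MeasurableSpace E] [BorelSpace E]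
  [FiniteDimensional ℝ E]

/-- A finite absolutely continuous measure is uniformly continuous under small translations. -/
theorem exists_measureReal_le_translate (ν : Measure E) [ν.IsAddHaarMeasure] {μ : Measure E}
    [IsFiniteMeasure μ] (hμ : μ ≪ ν) {η : ℝ} (hη : 0 < η) :
    ∃ ρ > 0, ∀ v : E, ‖v‖ < ρ → ∀ D : Set E, MeasurableSet D →
      μ.real D ≤ μ.real ((fun x => x - v) ⁻¹' D) + η := by
  set f : E → ℝ := fun x => (μ.rnDeriv ν x).toReal with hf
  have hfi : Integrable f ν := Measure.integrable_toReal_rnDeriv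
  have hfm : MemLp f 1 ν := memLp_one_iff_integrable.2 hfi
  have : Fact ((1 : ENNReal) ≤ 1) := ⟨le_rfl⟩
  have : Fact ((1 : ENNReal) ≠ ⊤) := ⟨by simp⟩
  -- Translation acts continuously on `L¹`; this is applied to the density of `μ`.
  have hcont : Continuous fun v : E => (DomAddAct.mk v) +ᵥ (hfm.toLp f) :=
    (continuous_id.vadd continuous_const).comp DomAddAct.continuous_mk
  obtain ⟨ρ, hρ, h⟩ := Metric.continuous_iff.1 hcont 0 η hη
  refine ⟨ρ, hρ, fun v hv D hD => ?_⟩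
  have h1 := h v (by simpa using hv)
  have h2 : ENNReal.ofReal (∫ x, ‖f (v + x) - f x‖ ∂ν) < ENNReal.ofReal η := by
    have hi : Integrable (fun x => f (v + x) - f x) ν := (hfi.comp_add_left v).sub hfi
    rw [ofReal_integral_norm_eq_lintegral_enorm hi, ← eLpNorm_one_eq_lintegral_enorm]
    rw [DomAddAct.mk_vadd_toLp, DomAddAct.mk_vadd_toLp, ← edist_lt_ofReal,
      Lp.edist_toLp_toLp] at h1
    convert h1 using 2
    ext x
    simp
  have h3 : ∫ x, ‖f (v + x) - f x‖ ∂ν < η := (ENNReal.ofReal_lt_ofReal_iff hη).1 h2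
  have e1 : μ.real D = ∫ x in D, f x ∂ν := (Measure.setIntegral_toReal_rnDeriv hμ D).symm
  have e2 : μ.real ((fun x => x - v) ⁻¹' D) = ∫ x in D, f (v + x) ∂ν := by
    rw [← Measure.setIntegral_toReal_rnDeriv hμ, ← integral_indicator hD,
      ← integral_indicator (show MeasurableSet ((fun x => x - v) ⁻¹' D) from
        hD.preimage (measurable_id.sub_const v)),
      ← integral_add_left_eq_self _ v]
    congr 1
    ext x
    have hx : v + x ∈ (fun x => x - v) ⁻¹' D ↔ x ∈ D := by
      rw [Set.mem_preimage, add_sub_cancel_left]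
    by_cases hxD : x ∈ D
    · rw [Set.indicator_of_mem hxD, Set.indicator_of_mem (hx.2 hxD)]
    · rw [Set.indicator_of_notMem hxD, Set.indicator_of_notMem (fun hc => hxD (hx.1 hc))]
  have hi : Integrable (fun x => f (v + x)) ν := hfi.comp_add_left v
  have e3 : (∫ x in D, f x ∂ν) - ∫ x in D, f (v + x) ∂ν ≤ ∫ x, ‖f (v + x) - f x‖ ∂ν := by
    rw [← integral_sub hfi.integrableOn hi.integrableOn]
    refine (integral_mono (μ := ν.restrict D) (hfi.sub hi).integrableOn
      (hi.sub hfi).norm.integrableOn fun x => ?_).trans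
      (setIntegral_le_integral (hi.sub hfi).norm (Filter.Eventually.of_forall fun x => norm_nonneg _))
    have := neg_abs_le (f (v + x) - f x)
    simp only [Pi.sub_apply, Real.norm_eq_abs]
    linarith
  linarith

/-- Under an absolutely continuous probability measure, the part of a convex set that leaves the
set under a small translation has uniformly small measure. -/
theorem exists_measureReal_diff_translate_le (ν : Measure E) [ν.IsAddHaarMeasure] {μ : Measure E}
    [IsProbabilityMeasure μ] (hμ : μ ≪ ν) {η : ℝ} (hη : 0 < η) :
    ∃ ρ > 0, ∀ T : Set E, Convex ℝ T → MeasurableSet T → ∀ w : E, ‖w‖ < ρ →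
      μ.real {x | x ∈ T ∧ x + w ∉ T} ≤ η := by
  obtain ⟨ρ, hρ, h⟩ := exists_measureReal_le_translate ν hμ (half_pos hη)
  -- The set `D` of points that leave `T` has `M` disjoint translates, each of mass at least `μ(D) -
  -- η/2`. They fit into total mass `1`, so `μ(D) ≤ 1/M + η/2 < η`.
  obtain ⟨M, hM⟩ := exists_nat_gt (2 / η)
  have hM0 : (0 : ℝ) < M := lt_trans (by positivity) hM
  refine ⟨ρ / M, by positivity, fun T hT hTm w hw => ?_⟩
  set D : Set E := {x | x ∈ T ∧ x + w ∉ T} with hD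
  have hDm : MeasurableSet D := hTm.inter (hTm.compl.preimage (measurable_id.add_const w))
  let S : ℕ → Set E := fun j => (fun x => x - (j : ℝ) • w) ⁻¹' D
  have hSm : ∀ j, MeasurableSet (S j) := fun j => hDm.preimage (measurable_id.sub_const _)
  -- The point `x - (j - 1)w` lies on the segment from `x - jw` to `x - iw`. Convexity keeps it in
  -- `T`, whereas `x - jw ∈ D` forbids this.
  have hlt : ∀ i j : ℕ, i < j → Disjoint (S i) (S j) := by
    intro i j hij
    rw [Set.disjoint_left]
    rintro x ⟨hi, -⟩ ⟨hj, hj'⟩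
    have hij' : (0 : ℝ) < (j : ℝ) - i := by
      have : (i : ℝ) < j := by exact_mod_cast hij
      linarith
    have hij1 : (1 : ℝ) ≤ (j : ℝ) - i := by
      have : (i : ℝ) + 1 ≤ j := by exact_mod_cast hij
      linarith
    apply hj'
    have := hT hi hj (a := 1 / ((j : ℝ) - i)) (b := 1 - 1 / ((j : ℝ) - i)) (by positivity)
      (by rw [sub_nonneg, div_le_one hij']; exact hij1) (by ring)
    convert this using 1
    have hne := hij'.ne'
    match_scalars
    · field_simp; ring
    · field_simp; ring
  have hdisj : Pairwise (Function.onFun Disjoint S) := by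
    intro i j hij
    rcases lt_or_gt_of_ne hij with h | h
    · exact hlt i j h
    · exact (hlt j i h).symm
  have hsum : ∑ j ∈ Finset.range M, μ.real (S j) ≤ 1 := by
    rw [← measureReal_biUnion_finset (fun i _ j _ hij => hdisj hij) fun j _ => hSm j]
    exact measureReal_le_one
  have hle : ∀ j ∈ Finset.range M, μ.real D - η / 2 ≤ μ.real (S j) := by
    intro j hj
    have := h ((j : ℝ) • w) (by
      rw [norm_smul, Real.norm_of_nonneg (by positivity)]
      have hj' : (j : ℝ) ≤ M := by exact_mod_cast (Finset.mem_range.1 hj).le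
      calc (j : ℝ) * ‖w‖ ≤ M * ‖w‖ := by gcongr
        _ < M * (ρ / M) := by gcongr
        _ = ρ := by field_simp) D hDm
    change _ ≤ μ.real (S j) + _ at this
    linarith
  have := (Finset.sum_le_sum hle).trans hsum
  rw [Finset.sum_const, Finset.card_range, nsmul_eq_mul] at this
  rw [div_lt_iff₀ hη] at hM
  by_contra! hc
  nlinarith

end Translate

/-! ### Boundary layers of convex sets and uniformity of weak convergence. -/

section Layer

variable {ℓ : ℕ}

/-- The vector of `ℝ^ℓ` with coordinates `1` on `s` and `-1` off `s`. -/
noncomputable def signVec (s : Finset (Fin ℓ)) : EuclideanSpace ℝ (Fin ℓ) :=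
  WithLp.toLp 2 fun i => if i ∈ s then 1 else -1

/-- The `ℓ¹` norm dominates the Euclidean norm. Thus finitely many directions, fixed before `A`,
serve all separating functionals. -/
theorem exists_norm_le_inner_signVec (u : EuclideanSpace ℝ (Fin ℓ)) :
    ∃ s, ‖u‖ ≤ inner ℝ u (signVec s) := by
  refine ⟨Finset.univ.filter fun i => 0 ≤ u i, ?_⟩
  have h1 : inner ℝ u (signVec (Finset.univ.filter fun i => 0 ≤ u i)) = ∑ i, |u i| := by
    simp only [PiLp.inner_apply, signVec]
    refine Finset.sum_congr rfl fun i _ => ?_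
    by_cases h : 0 ≤ u i
    · simp [h, abs_of_nonneg]
    · simp [h, abs_of_neg (not_le.1 h)]
  rw [h1, EuclideanSpace.norm_eq]
  refine Real.sqrt_le_iff.2 ⟨Finset.sum_nonneg fun i _ => abs_nonneg _, ?_⟩
  exact Finset.sum_sq_le_sq_sum_of_nonneg fun i _ => abs_nonneg _

/-- The points near `A` and near a point that is weakly separated from `A`. -/
def boundaryLayer (ε : ℝ) (A : Set (EuclideanSpace ℝ (Fin ℓ))) :
    Set (EuclideanSpace ℝ (Fin ℓ)) :=
  {x | x ∈ Metric.thickening ε A ∧ ∃ z, dist x z < ε ∧ ∃ u : EuclideanSpace ℝ (Fin ℓ), u ≠ 0 ∧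
    ∀ a ∈ A, inner ℝ u a ≤ inner ℝ u z}

/-- On the thickening of `A`, `⟨u, ·⟩` is at most `⟨u, x⟩ + 2ε‖u‖`: one `ε` for the distance from
`x` to `z`, one for the distance to `A`. A move by `3ε` along a suitable sign vector exceeds this
bound. -/
theorem boundaryLayer_subset (ε : ℝ) (A : Set (EuclideanSpace ℝ (Fin ℓ))) :
    boundaryLayer ε A ⊆ ⋃ s : Finset (Fin ℓ), {x | x ∈ Metric.thickening ε A ∧
      x + (3 * ε) • signVec s ∉ Metric.thickening ε A} := by
  rintro x ⟨hx, z, hxz, u, hu, hsep⟩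
  have hε : 0 < ε := dist_nonneg.trans_lt hxz
  obtain ⟨s, hs⟩ := exists_norm_le_inner_signVec u
  refine Set.mem_iUnion.2 ⟨s, hx, fun hmem => ?_⟩
  obtain ⟨a, ha, hd⟩ := Metric.mem_thickening_iff.1 hmem
  have hu0 : 0 < ‖u‖ := norm_pos_iff.2 hu
  have h1 := hsep a ha
  have h2 : inner ℝ u (x + (3 * ε) • signVec s - a) ≤ ‖u‖ * ε :=
    (real_inner_le_norm _ _).trans (by rw [← dist_eq_norm]; gcongr)
  have h3 : inner ℝ u (z - x) ≤ ‖u‖ * ε :=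
    (real_inner_le_norm _ _).trans (by rw [← dist_eq_norm, dist_comm]; gcongr)
  rw [inner_sub_right, inner_add_right, inner_smul_right] at h2
  rw [inner_sub_right] at h3
  nlinarith

theorem exists_measureReal_boundaryLayer_le {μ : Measure (EuclideanSpace ℝ (Fin ℓ))}
    [IsProbabilityMeasure μ] (hμ : μ ≪ volume) {η : ℝ} (hη : 0 < η) :
    ∃ ε₀ > 0, ∀ ε < ε₀, ∀ A, Convex ℝ A → μ.real (boundaryLayer ε A) ≤ η := by
  -- A union bound over the `2 ^ ℓ` sign vectors follows.
  obtain ⟨ρ, hρ, h⟩ := exists_measureReal_diff_translate_le volume hμ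
    (η := η / 2 ^ ℓ) (by positivity)
  let K : ℝ := ∑ s : Finset (Fin ℓ), ‖signVec s‖
  have hK : 0 ≤ K := Finset.sum_nonneg fun _ _ => norm_nonneg _
  refine ⟨ρ / (3 * (K + 1)), by positivity, fun ε hε A hA => ?_⟩
  rcases le_or_gt ε 0 with hε0 | hε0
  · have : boundaryLayer ε A = ∅ := by
      ext x
      simp [boundaryLayer, Metric.thickening_of_nonpos hε0]
    simp [this, hη.le]
  refine (measureReal_mono (boundaryLayer_subset ε A)).trans
    ((measureReal_iUnion_fintype_le _).trans ?_)
  have : ∀ s : Finset (Fin ℓ), μ.real {x | x ∈ Metric.thickening ε A ∧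
      x + (3 * ε) • signVec s ∉ Metric.thickening ε A} ≤ η / 2 ^ ℓ := by
    intro s
    refine h _ (hA.thickening ε) Metric.isOpen_thickening.measurableSet _ ?_
    rw [norm_smul, Real.norm_of_nonneg (by positivity)]
    have hsK : ‖signVec s‖ ≤ K :=
      Finset.single_le_sum (f := fun s => ‖signVec s‖) (fun _ _ => norm_nonneg _)
        (Finset.mem_univ s)
    rw [lt_div_iff₀ (by positivity)] at hε
    nlinarith
  refine (Finset.sum_le_sum fun s _ => this s).trans (le_of_eq ?_)
  simp
  field_simp

/-- A point outside the closure of `A` is itself separated from `A` by Hahn–Banach, so it serves as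
its own `z`. -/
theorem thickening_subset_interior_union {A : Set (EuclideanSpace ℝ (Fin ℓ))} (hA : Convex ℝ A)
    {ε : ℝ} (hε : 0 < ε) :
    Metric.thickening ε A ⊆ interior A ∪ (frontier A ∪ boundaryLayer ε A) := by
  intro x hx
  by_cases hc : x ∈ closure A
  · by_cases hi : x ∈ interior A
    · exact Or.inl hi
    · exact Or.inr (Or.inl ⟨hc, hi⟩)
  refine Or.inr (Or.inr ⟨hx, x, by simpa using hε, ?_⟩)
  obtain ⟨f, u, hf, hu⟩ := geometric_hahn_banach_closed_point hA.closure isClosed_closure hc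
  refine ⟨(InnerProductSpace.toDual ℝ _).symm f, ?_, fun a ha => ?_⟩
  · rintro h0
    obtain ⟨a, ha, -⟩ := Metric.mem_thickening_iff.1 hx
    have := hf a (subset_closure ha)
    simp only [EmbeddingLike.map_eq_zero_iff] at h0
    simp [h0] at this hu
    linarith
  · simp only [InnerProductSpace.toDual_symm_apply]
    exact ((hf a (subset_closure ha)).trans hu).le

/-- The inner counterpart: a nearby point outside the open convex set `interior A` is separated from
it, and the separation passes to `A` because a nonempty interior is dense in the closure. If the
interior is empty, `A` lies in its frontier. -/
theorem subset_compl_thickening_union {A : Set (EuclideanSpace ℝ (Fin ℓ))} (hA : Convex ℝ A)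
    {ε : ℝ} (hε : 0 < ε) :
    A ⊆ (Metric.thickening ε (interior A)ᶜ)ᶜ ∪ (frontier A ∪ boundaryLayer ε A) := by
  intro x hx
  by_cases hi : x ∈ interior A
  swap
  · exact Or.inr (Or.inl ⟨subset_closure hx, hi⟩)
  by_cases ht : x ∈ Metric.thickening ε (interior A)ᶜ
  swap
  · exact Or.inl ht
  obtain ⟨z, hz, hxz⟩ := Metric.mem_thickening_iff.1 ht
  refine Or.inr (Or.inr ⟨Metric.self_subset_thickening hε A hx, z, hxz, ?_⟩)
  obtain ⟨f, hf⟩ := geometric_hahn_banach_open_point hA.interior isOpen_interior hz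
  refine ⟨(InnerProductSpace.toDual ℝ _).symm f, ?_, fun a ha => ?_⟩
  · rintro h0
    simp only [EmbeddingLike.map_eq_zero_iff] at h0
    simpa [h0] using hf x hi
  · simp only [InnerProductSpace.toDual_symm_apply]
    have hcl : a ∈ closure (interior A) := by
      rw [hA.closure_interior_eq_closure_of_nonempty_interior ⟨x, hi⟩]
      exact subset_closure ha
    have hcs : IsClosed {y | f y ≤ f z} := isClosed_le f.continuous continuous_const
    exact closure_minimal (fun y hy => (hf y hy).le) hcs hcl

/-- Weak convergence to an absolutely continuous law on `ℝ^ℓ` is uniform over convex sets. -/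
theorem eventually_forall_convex_abs_sub_le {P : ℕ → ProbabilityMeasure (EuclideanSpace ℝ (Fin ℓ))}
    {μ : ProbabilityMeasure (EuclideanSpace ℝ (Fin ℓ))}
    (hP : Filter.Tendsto P Filter.atTop (nhds μ))
    (hμ : (μ : Measure (EuclideanSpace ℝ (Fin ℓ))) ≪ volume) {η : ℝ} (hη : 0 < η) :
    ∀ᶠ n in Filter.atTop, ∀ A, Convex ℝ A → MeasurableSet A →
      |(P n : Measure (EuclideanSpace ℝ (Fin ℓ))).real A
        - (μ : Measure (EuclideanSpace ℝ (Fin ℓ))).real A| ≤ η := by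
  obtain ⟨ε₀, hε₀, hlayer⟩ := exists_measureReal_boundaryLayer_le hμ (half_pos hη)
  obtain ⟨c, hc0, hc1, hc2⟩ : ∃ c : ℝ, 0 < c ∧ c < ε₀ ∧ c ≤ η / 2 :=
    ⟨min (ε₀ / 2) (η / 2), by positivity, (min_le_left _ _).trans_lt (by linarith),
      min_le_right _ _⟩
  -- Weak convergence is convergence in the Lévy–Prokhorov metric. Its one-sided comparison is used
  -- for `A` and for the complement of `interior A`, which gives both inequalities.
  have hlp := (LevyProkhorov.probabilityMeasureHomeomorph.continuous.tendsto μ).comp hP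
  have hev := (EMetric.tendsto_nhds.1 hlp) (ENNReal.ofReal c) (by simpa using hc0)
  filter_upwards [hev] with n hn A hA hAm
  set p : Measure (EuclideanSpace ℝ (Fin ℓ)) := (P n).toMeasure with hp
  set m : Measure (EuclideanSpace ℝ (Fin ℓ)) := μ.toMeasure with hm
  have hd : levyProkhorovEDist p m < ENNReal.ofReal c := hn
  have key : ∀ B : Set (EuclideanSpace ℝ (Fin ℓ)), MeasurableSet B →
      p.real B ≤ m.real (Metric.thickening c B) + c := by
    intro B hB
    have h1 := left_measure_le_of_levyProkhorovEDist_lt hd hB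
    rw [ENNReal.toReal_ofReal hc0.le] at h1
    have h2 := ENNReal.toReal_mono (by simp) h1
    rwa [ENNReal.toReal_add (by simp) (by simp), ENNReal.toReal_ofReal hc0.le] at h2
  have hfr : m.real (frontier A) = 0 := by
    rw [measureReal_def, hμ (hA.addHaar_frontier volume), ENNReal.toReal_zero]
  have hl := hlayer c hc1 A hA
  have hun : m.real (frontier A ∪ boundaryLayer c A) ≤ η / 2 :=
    (measureReal_union_le _ _).trans (by rw [hfr]; linarith)
  have h1 : p.real A ≤ m.real A + η / 2 + c := by
    have e1 := key A hAm
    have e2 : m.real (Metric.thickening c A) ≤ m.real (interior A) + η / 2 :=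
      (measureReal_mono (thickening_subset_interior_union hA hc0)).trans
        ((measureReal_union_le _ _).trans (by linarith))
    have e3 : m.real (interior A) ≤ m.real A := measureReal_mono interior_subset
    linarith
  have h2 : m.real A ≤ p.real A + η / 2 + c := by
    have e1 := key (interior A)ᶜ isOpen_interior.measurableSet.compl
    have e2 : m.real A ≤ m.real (Metric.thickening c (interior A)ᶜ)ᶜ + η / 2 :=
      (measureReal_mono (subset_compl_thickening_union hA hc0)).trans
        ((measureReal_union_le _ _).trans (by linarith))
    have e3 : p.real (interior A) ≤ p.real A := measureReal_mono interior_subset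
    rw [probReal_compl_eq_one_sub isOpen_interior.measurableSet] at e1
    rw [probReal_compl_eq_one_sub Metric.isOpen_thickening.measurableSet] at e2
    linarith
  rw [abs_le]
  constructor <;> linarith

end Layer

/-! ### Gaussian approximation of products of characteristic functions. -/

section CharFun

theorem norm_prod_sub_prod_le_sum {ι : Type*} (s : Finset ι) (f g : ι → ℂ)
    (hf : ∀ i, ‖f i‖ ≤ 1) (hg : ∀ i, ‖g i‖ ≤ 1) :
    ‖∏ i ∈ s, f i - ∏ i ∈ s, g i‖ ≤ ∑ i ∈ s, ‖f i - g i‖ := by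
  classical
  induction s using Finset.induction_on with
  | empty => simp
  | insert a s ha ih =>
    rw [Finset.prod_insert ha, Finset.prod_insert ha, Finset.sum_insert ha]
    have h1 : f a * ∏ i ∈ s, f i - g a * ∏ i ∈ s, g i
        = (f a - g a) * ∏ i ∈ s, f i + g a * (∏ i ∈ s, f i - ∏ i ∈ s, g i) := by ring
    have h2 : ‖∏ i ∈ s, f i‖ ≤ 1 := by
      rw [norm_prod]
      exact Finset.prod_le_one (fun _ _ => norm_nonneg _) fun i _ => hf i
    rw [h1]
    refine (norm_add_le _ _).trans (add_le_add ?_ ?_)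
    · rw [norm_mul]
      exact mul_le_of_le_one_right (norm_nonneg _) h2
    · rw [norm_mul]
      exact (mul_le_of_le_one_left (norm_nonneg _) (hg a)).trans ih

/-- A characteristic function with finite variance agrees with that of the Gaussian law of the
same mean and variance up to `o(t²)` at `0`. -/
theorem charFun_sub_exp_isLittleO {ζ : Measure ℝ} [IsProbabilityMeasure ζ] (hζ : MemLp id 2 ζ) :
    (fun t : ℝ => charFun ζ t
      - Complex.exp (((∫ x, x ∂ζ) * t : ℝ) * Complex.I - (Var[id; ζ] * t ^ 2 / 2 : ℝ)))
      =o[nhds 0] fun t => t ^ 2 := by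
  set m : ℝ := ∫ x, x ∂ζ with hm
  set γ : Measure ℝ := gaussianReal m (Var[id; ζ]).toNNReal with hγ
  have hγ2 : MemLp id 2 γ := IsGaussian.memLp_two_id
  have h1 := taylor_isLittleO_univ (x₀ := 0) (contDiff_charFun (n := 2) (μ := ζ) hζ)
  have h2 := taylor_isLittleO_univ (x₀ := 0) (contDiff_charFun (n := 2) (μ := γ) hγ2)
  have hmγ : ∫ x, x ∂γ = m := by simp [hγ]
  have hvγ : Var[id; γ] = Var[id; ζ] := by
    rw [hγ, variance_id_gaussianReal, Real.coe_toNNReal _ (variance_nonneg _ _)]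
  have hsq : ∫ x, x ^ 2 ∂γ = ∫ x, x ^ 2 ∂ζ := by
    have e1 := variance_eq_sub hζ
    have e2 := variance_eq_sub hγ2
    simp only [id, Pi.pow_apply, hmγ] at e1 e2 hvγ
    rw [← hm] at e1
    linarith
  -- The second-order Taylor polynomial depends only on the first two moments, which agree.
  have hT : ∀ t, taylorWithinEval (charFun ζ) 2 Set.univ 0 t
      = taylorWithinEval (charFun γ) 2 Set.univ 0 t := by
    intro t
    rw [taylorWithinEval_charFun_zero hζ, taylorWithinEval_charFun_zero hγ2]
    simp only [Finset.sum_range_succ, Finset.sum_range_zero, pow_one, hsq, hmγ]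
    simp [hm]
  have h3 := h1.sub h2
  simp only [sub_zero] at h3
  refine h3.congr (fun t => ?_) fun t => rfl
  rw [hT t, sub_sub_sub_cancel_right, hγ, charFun_gaussianReal]
  congr 2
  rw [Real.coe_toNNReal _ (variance_nonneg _ _)]
  push_cast
  ring

theorem norm_exp_mul_I_sub_le_one (a b : ℝ) (hb : 0 ≤ b) :
    ‖Complex.exp ((a : ℝ) * Complex.I - (b : ℝ))‖ ≤ 1 := by
  rw [Complex.norm_exp]
  simp [hb]

/-- A product of characteristic functions at small arguments is nearly Gaussian, uniformly in the
number of factors. -/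
theorem exists_norm_prod_charFun_sub_le {ζ : Measure ℝ} [IsProbabilityMeasure ζ]
    (hζ : MemLp id 2 ζ) {ε : ℝ} (hε : 0 < ε) :
    ∃ δ > 0, ∀ (J : Type) [Fintype J] (y : J → ℝ), (∀ p, |y p| ≤ δ) →
      ‖∏ p, charFun ζ (y p) - Complex.exp (((∫ x, x ∂ζ) * ∑ p, y p : ℝ) * Complex.I
        - (Var[id; ζ] * (∑ p, y p ^ 2) / 2 : ℝ))‖ ≤ ε * ∑ p, y p ^ 2 := by
  have h := (charFun_sub_exp_isLittleO hζ).bound hε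
  rw [Metric.eventually_nhds_iff] at h
  obtain ⟨δ, hδ, h⟩ := h
  refine ⟨δ / 2, by positivity, fun J _ y hy => ?_⟩
  have hexp : Complex.exp (((∫ x, x ∂ζ) * ∑ p, y p : ℝ) * Complex.I
        - (Var[id; ζ] * (∑ p, y p ^ 2) / 2 : ℝ)) = ∏ p, Complex.exp (((∫ x, x ∂ζ) * y p : ℝ)
          * Complex.I - (Var[id; ζ] * y p ^ 2 / 2 : ℝ)) := by
    rw [← Complex.exp_sum, Finset.sum_sub_distrib, ← Finset.sum_mul]
    push_cast
    rw [Finset.mul_sum, Finset.mul_sum, Finset.sum_div]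
  rw [hexp, Finset.mul_sum]
  refine (norm_prod_sub_prod_le_sum _ _ _ (fun p => norm_charFun_le_one _)
    fun p => norm_exp_mul_I_sub_le_one _ _ ?_).trans (Finset.sum_le_sum fun p _ => ?_)
  · have := variance_nonneg id ζ
    positivity
  · have := h (y := y p) (by rw [Real.dist_eq, sub_zero]; linarith [hy p])
    simpa using this

theorem integral_exp_sum_pi {J : Type*} [Fintype J] (ζ : Measure ℝ) [IsProbabilityMeasure ζ]
    (y : J → ℝ) :
    ∫ c : J → ℝ, Complex.exp ((∑ p, c p * y p : ℝ) * Complex.I) ∂(Measure.pi fun _ => ζ)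
      = ∏ p, charFun ζ (y p) := by
  have h := integral_fintype_prod_eq_prod (𝕜 := ℂ) (μ := fun _ : J => ζ)
    (f := fun p (x : ℝ) => Complex.exp ((x * y p : ℝ) * Complex.I))
  simp only [charFun_apply_real]
  refine Eq.trans (integral_congr_ae (.of_forall fun c => ?_)) (h.trans
    (Finset.prod_congr rfl fun p _ => integral_congr_ae (.of_forall fun x => ?_)))
  · simp only
    rw [← Complex.exp_sum]
    push_cast
    rw [Finset.sum_mul]
  · simp only
    push_cast
    ring_nf

end CharFun

/-! ### Moments of i.i.d. families. -/

section Moments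

variable {J : Type*} [Fintype J]

theorem ae_pi_of_ae {μ : Measure ℝ} [IsProbabilityMeasure μ] {p : ℝ → Prop} (h : ∀ᵐ x ∂μ, p x) :
    ∀ᵐ s ∂(Measure.pi fun _ : J => μ), ∀ q, p (s q) :=
  ae_all_iff.2 fun q =>
    (measurePreserving_eval (fun _ : J => μ) q).quasiMeasurePreserving.ae h

theorem memLp_eval_pi {μ : Measure ℝ} [IsProbabilityMeasure μ] {r : ENNReal} (h : MemLp id r μ)
    (q : J) : MemLp (fun s : J → ℝ => s q) r (Measure.pi fun _ => μ) :=
  h.comp_measurePreserving (measurePreserving_eval (fun _ : J => μ) q)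

theorem integral_eval_pi (μ : Measure ℝ) [IsProbabilityMeasure μ] (q : J) (f : ℝ → ℝ)
    (hf : Measurable f) :
    ∫ s : J → ℝ, f (s q) ∂(Measure.pi fun _ => μ) = ∫ x, f x ∂μ := by
  have h := integral_map (μ := Measure.pi fun _ : J => μ) (measurable_pi_apply q).aemeasurable
    (f := f) hf.aestronglyMeasurable
  rw [← h]
  congr 1
  exact (measurePreserving_eval (fun _ : J => μ) q).map_eq

theorem iIndepFun_eval_pi (μ : Measure ℝ) [IsProbabilityMeasure μ] :
    iIndepFun (fun (q : J) (s : J → ℝ) => s q) (Measure.pi fun _ => μ) :=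
  iIndepFun_pi (μ := fun _ : J => μ) (X := fun _ x => x) fun _ => aemeasurable_id

theorem integral_eval_mul_eval_pi [DecidableEq J] (μ : Measure ℝ) [IsProbabilityMeasure μ]
    (i j : J) :
    ∫ s : J → ℝ, s i * s j ∂(Measure.pi fun _ => μ)
      = if i = j then ∫ x, x ^ 2 ∂μ else (∫ x, x ∂μ) ^ 2 := by
  split_ifs with h
  · subst h
    simp only [← sq]
    exact integral_eval_pi μ i (fun x => x ^ 2) (by fun_prop)
  · rw [((iIndepFun_eval_pi μ).indepFun h).integral_fun_mul_eq_mul_integral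
      (measurable_pi_apply i).aestronglyMeasurable (measurable_pi_apply j).aestronglyMeasurable,
      integral_eval_pi μ i (fun x => x) measurable_id,
      integral_eval_pi μ j (fun x => x) measurable_id, sq]

end Moments

/-! ### The random coefficients and the concentration of their squares. -/

section RowForm

variable {ℓ : ℕ} {J : Type}

/-- The coefficient of `c p` in `∑ a, u a * ∑ p, ξ a p * s (π a p) * c p`. -/
def rowForm (u : Fin ℓ → ℝ) (ξ : Fin ℓ → J → ℝ) (π : Fin ℓ → Equiv.Perm J) (s : J → ℝ) (p : J) :
    ℝ := ∑ a, u a * (ξ a p * s (π a p))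

/-- The coefficient of `s q` in `∑ p, rowForm u ξ π s p`. -/
def colForm (u : Fin ℓ → ℝ) (ξ : Fin ℓ → J → ℝ) (π : Fin ℓ → Equiv.Perm J) (q : J) : ℝ :=
  ∑ a, u a * ξ a ((π a).symm q)

variable {u : Fin ℓ → ℝ} {ξ : Fin ℓ → J → ℝ} {π : Fin ℓ → Equiv.Perm J}

@[fun_prop]
theorem measurable_rowForm (p : J) : Measurable fun s => rowForm u ξ π s p := by
  unfold rowForm
  fun_prop

theorem abs_eq_one_of_sq {x : ℝ} (h : x ^ 2 = 1) : |x| = 1 := by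
  rw [← abs_one, ← sq_eq_sq_iff_abs_eq_abs, h, one_pow]

theorem abs_rowForm_le (hξ : ∀ a p, ξ a p ^ 2 = 1) {B : ℝ} {s : J → ℝ} (hs : ∀ q, |s q| ≤ B)
    (p : J) : |rowForm u ξ π s p| ≤ B * ∑ a, |u a| := by
  refine (Finset.abs_sum_le_sum_abs _ _).trans ?_
  rw [Finset.mul_sum]
  refine Finset.sum_le_sum fun a _ => ?_
  rw [abs_mul, abs_mul, abs_eq_one_of_sq (hξ a p), one_mul, mul_comm]
  exact mul_le_mul_of_nonneg_right (hs _) (abs_nonneg _)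

theorem abs_colForm_le (hξ : ∀ a p, ξ a p ^ 2 = 1) (q : J) :
    |colForm u ξ π q| ≤ ∑ a, |u a| := by
  refine (Finset.abs_sum_le_sum_abs _ _).trans (Finset.sum_le_sum fun a _ => ?_)
  rw [abs_mul, abs_eq_one_of_sq (hξ a _), mul_one]

variable [Fintype J]

theorem sum_rowForm (s : J → ℝ) : ∑ p, rowForm u ξ π s p = ∑ q, s q * colForm u ξ π q := by
  simp only [rowForm, colForm, Finset.mul_sum]
  rw [Finset.sum_comm, Finset.sum_comm (s := Finset.univ (α := J))]
  refine Finset.sum_congr rfl fun a _ => ?_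
  rw [← Equiv.sum_comp (π a) fun q => s q * (u a * ξ a ((π a).symm q))]
  refine Finset.sum_congr rfl fun p _ => ?_
  rw [Equiv.symm_apply_apply]
  ring

variable {ρ : Measure ℝ} [IsProbabilityMeasure ρ]

theorem integral_sq_eq_variance (hρ : MemLp id 2 ρ) (h0 : ∫ x, x ∂ρ = 0) :
    ∫ x, x ^ 2 ∂ρ = Var[id; ρ] := by
  rw [variance_eq_sub hρ]
  simp [h0]

/-- Injectivity of `a ↦ π a p` makes the `ℓ` entries of `s` distinct, so the cross terms vanish. -/
theorem integral_rowForm_sq (hρ : MemLp id 2 ρ) (h0 : ∫ x, x ∂ρ = 0)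
    (hξ : ∀ a p, ξ a p ^ 2 = 1) (p : J) (hπ : Function.Injective fun a => π a p) :
    ∫ s, rowForm u ξ π s p ^ 2 ∂(Measure.pi fun _ => ρ) = Var[id; ρ] * ∑ a, u a ^ 2 := by
  classical
  have hint : ∀ a b, Integrable (fun s : J → ℝ => s (π a p) * s (π b p))
      (Measure.pi fun _ => ρ) := fun a b =>
    (memLp_eval_pi hρ _).integrable_mul (memLp_eval_pi hρ _)
  have h1 : ∀ s : J → ℝ, rowForm u ξ π s p ^ 2
      = ∑ a, ∑ b, (u a * ξ a p * (u b * ξ b p)) * (s (π a p) * s (π b p)) := by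
    intro s
    rw [sq, rowForm, Finset.sum_mul_sum]
    refine Finset.sum_congr rfl fun a _ => Finset.sum_congr rfl fun b _ => by ring
  simp only [h1]
  rw [integral_finsetSum _ fun a _ => integrable_finsetSum _ fun b _ => (hint a b).const_mul _,
    Finset.mul_sum]
  refine Finset.sum_congr rfl fun a _ => ?_
  rw [integral_finsetSum _ fun b _ => (hint a b).const_mul _]
  simp only [integral_const_mul, integral_eval_mul_eval_pi, h0, integral_sq_eq_variance hρ h0]
  rw [Finset.sum_eq_single a]
  · simp only [if_true]
    linear_combination (u a ^ 2 * Var[id; ρ]) * hξ a p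
  · intro b _ hb
    rw [if_neg fun h => hb (hπ h).symm]
    simp
  · simp

/-- Such a pair is determined by `a`, `b` and its first component. -/
theorem card_overlap_le [DecidableEq J] :
    (((Finset.univ : Finset (J × J)).filter fun x => ∃ a b, π a x.1 = π b x.2).card : ℝ)
      ≤ (ℓ : ℝ) ^ 2 * Fintype.card J := by
  have hsub : ((Finset.univ : Finset (J × J)).filter fun x => ∃ a b, π a x.1 = π b x.2)
      ⊆ (Finset.univ : Finset ((Fin ℓ × Fin ℓ) × J)).image
        fun y => (y.2, (π y.1.2).symm (π y.1.1 y.2)) := by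
    rintro ⟨p, p'⟩ hx
    obtain ⟨a, b, hab⟩ := (Finset.mem_filter.1 hx).2
    exact Finset.mem_image.2 ⟨((a, b), p), Finset.mem_univ _, by simp [hab]⟩
  have h := (Finset.card_le_card hsub).trans Finset.card_image_le
  rw [Finset.card_univ, Fintype.card_prod, Fintype.card_prod, Fintype.card_fin] at h
  calc _ ≤ ((ℓ * ℓ * Fintype.card J : ℕ) : ℝ) := by exact_mod_cast h
    _ = _ := by push_cast; ring

/-- A quantitative weak law of large numbers: the centred squares at `p` and `p'` are independent
unless they share an entry of `s`. Hence only `ℓ²|J|` of the `|J|²` covariances can survive, each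
bounded by the fourth power of the bound on `rowForm`. -/
theorem integral_sq_sum_rowForm_sq_sub_le {B : ℝ} (hB : ∀ᵐ x ∂ρ, |x| ≤ B) (h0 : ∫ x, x ∂ρ = 0)
    (hξ : ∀ a p, ξ a p ^ 2 = 1) (hπ : ∀ p, Function.Injective fun a => π a p) :
    ∫ s, (∑ p, (rowForm u ξ π s p ^ 2 - Var[id; ρ] * ∑ a, u a ^ 2)) ^ 2
      ∂(Measure.pi fun _ => ρ) ≤ (ℓ : ℝ) ^ 2 * Fintype.card J * (B * ∑ a, |u a|) ^ 4 := by
  classical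
  set P : Measure (J → ℝ) := Measure.pi fun _ => ρ with hP
  set M : ℝ := Var[id; ρ] * ∑ a, u a ^ 2 with hM
  set C : ℝ := B * ∑ a, |u a| with hC
  have hρ : MemLp id 2 ρ := MemLp.of_bound aestronglyMeasurable_id B (by simpa using hB)
  have hM0 : 0 ≤ M := mul_nonneg (variance_nonneg _ _) (Finset.sum_nonneg fun _ _ => sq_nonneg _)
  have hae : ∀ᵐ s ∂P, ∀ p, rowForm u ξ π s p ^ 2 ≤ C ^ 2 := by
    filter_upwards [ae_pi_of_ae (J := J) hB] with s hs p
    rw [← sq_abs]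
    exact pow_le_pow_left₀ (abs_nonneg _) (abs_rowForm_le hξ hs p) 2
  have hEq : ∀ p, ∫ s, rowForm u ξ π s p ^ 2 ∂P = M := fun p =>
    integral_rowForm_sq hρ h0 hξ p (hπ p)
  have hintsq : ∀ p, Integrable (fun s => rowForm u ξ π s p ^ 2) P := fun p =>
    Integrable.of_bound ((measurable_rowForm p).pow_const 2).aestronglyMeasurable (C ^ 2) (by
      filter_upwards [hae] with s hs
      rw [Real.norm_of_nonneg (sq_nonneg _)]
      exact hs p)
  have hMC : ∀ _ : J, M ≤ C ^ 2 := by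
    intro p
    rw [← hEq p]
    refine (integral_mono_ae (hintsq p) (integrable_const (C ^ 2)) ?_).trans (by simp)
    filter_upwards [hae] with s hs using hs p
  let g : J → (J → ℝ) → ℝ := fun p s => rowForm u ξ π s p ^ 2 - M
  have hgm : ∀ p, Measurable (g p) := fun p => ((measurable_rowForm p).pow_const 2).sub_const _
  have hgb : ∀ᵐ s ∂P, ∀ p, |g p s| ≤ C ^ 2 := by
    filter_upwards [hae] with s hs p
    have h1 := hs p
    have h2 := hMC p
    have h3 := sq_nonneg (rowForm u ξ π s p)
    rw [abs_le]
    constructor <;> simp only [g] <;> linarith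
  have hg0 : ∀ p, ∫ s, g p s ∂P = 0 := by
    intro p
    simp only [g]
    rw [integral_sub (hintsq p) (integrable_const _), hEq p]
    simp
  have hggb : ∀ᵐ s ∂P, ∀ p p', |g p s * g p' s| ≤ C ^ 4 := by
    filter_upwards [hgb] with s hs p p'
    rw [abs_mul, show C ^ 4 = C ^ 2 * C ^ 2 by ring]
    exact mul_le_mul (hs p) (hs p') (abs_nonneg _) (sq_nonneg _)
  have hggi : ∀ p p', Integrable (fun s => g p s * g p' s) P := fun p p' =>
    Integrable.of_bound ((hgm p).mul (hgm p')).aestronglyMeasurable (C ^ 4) (by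
      filter_upwards [hggb] with s hs using hs p p')
  have hindep : ∀ p p', (¬ ∃ a b, π a p = π b p') → ∫ s, g p s * g p' s ∂P = 0 := by
    intro p p' hpp
    let S : J → Finset J := fun p => Finset.univ.image fun a => π a p
    have hd : Disjoint (S p) (S p') := by
      rw [Finset.disjoint_left]
      intro q hq hq'
      obtain ⟨a, -, ha⟩ := Finset.mem_image.1 hq
      obtain ⟨b, -, hb⟩ := Finset.mem_image.1 hq'
      exact hpp ⟨a, b, ha.trans hb.symm⟩
    have hmem : ∀ p a, π a p ∈ S p := fun p a => Finset.mem_image_of_mem _ (Finset.mem_univ a)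
    let G : ∀ p, (S p → ℝ) → ℝ := fun p r =>
      (∑ a, u a * (ξ a p * r ⟨π a p, hmem p a⟩)) ^ 2 - M
    have hGm : ∀ p, Measurable (G p) := fun p => by fun_prop
    have hi := ((iIndepFun_eval_pi (J := J) ρ).indepFun_finset (S p) (S p') hd
      fun q => measurable_pi_apply q).comp (hGm p) (hGm p')
    have := hi.integral_fun_mul_eq_mul_integral (hgm p).aestronglyMeasurable
      (hgm p').aestronglyMeasurable
    refine Eq.trans this ?_
    have h1 : ∫ s, g p s ∂P = 0 := hg0 p
    exact mul_eq_zero_of_left h1 _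
  have hexp : ∀ s, (∑ p, (rowForm u ξ π s p ^ 2 - M)) ^ 2
      = ∑ x : J × J, g x.1 s * g x.2 s := by
    intro s
    rw [sq, Finset.sum_mul_sum, ← Finset.univ_product_univ, Finset.sum_product]
  simp only [hexp]
  rw [integral_finsetSum _ fun x _ => hggi x.1 x.2]
  rw [← Finset.sum_filter_add_sum_filter_not Finset.univ fun x : J × J => ∃ a b, π a x.1 = π b x.2]
  rw [Finset.sum_eq_zero (s := Finset.univ.filter fun x : J × J => ¬ ∃ a b, π a x.1 = π b x.2)
    fun x hx => hindep x.1 x.2 (Finset.mem_filter.1 hx).2, add_zero]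
  have hC4 : 0 ≤ C ^ 4 := by positivity
  refine (Finset.sum_le_card_nsmul _ _ (C ^ 4) fun x _ => ?_).trans ?_
  · refine (integral_mono_ae (hggi x.1 x.2) (integrable_const (C ^ 4)) ?_).trans (by simp)
    filter_upwards [hggb] with s hs using (le_abs_self _).trans (hs _ _)
  · rw [nsmul_eq_mul]
    exact mul_le_mul_of_nonneg_right card_overlap_le hC4

end RowForm

/-! ### The central limit theorem for one bilinear form. -/

section Block

/-- The phase has modulus one, and `x ↦ exp (-x)` is 1-Lipschitz on `[0, ∞)`. -/
theorem norm_exp_sub_exp_le (z : ℝ) {a b : ℝ} (ha : 0 ≤ a) (hb : 0 ≤ b) :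
    ‖Complex.exp ((z : ℝ) * Complex.I - (a : ℝ)) - Complex.exp ((z : ℝ) * Complex.I - (b : ℝ))‖
      ≤ |a - b| := by
  have h : Complex.exp ((z : ℝ) * Complex.I - (a : ℝ)) - Complex.exp ((z : ℝ) * Complex.I - (b : ℝ))
      = Complex.exp ((z : ℝ) * Complex.I) * ((Real.exp (-a) - Real.exp (-b) : ℝ) : ℂ) := by
    push_cast
    rw [sub_eq_add_neg _ (a : ℂ), sub_eq_add_neg _ (b : ℂ), Complex.exp_add, Complex.exp_add]
    ring
  rw [h, norm_mul, Complex.norm_exp_ofReal_mul_I, one_mul, Complex.norm_real, Real.norm_eq_abs]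
  have key : ∀ {x y : ℝ}, 0 ≤ x → x ≤ y → |Real.exp (-x) - Real.exp (-y)| ≤ |x - y| := by
    intro x y hx hxy
    rw [abs_of_nonneg (sub_nonneg.2 (Real.exp_le_exp.2 (by linarith))), abs_sub_comm,
      abs_of_nonneg (by linarith)]
    have h1 : Real.exp (-y) = Real.exp (-x) * Real.exp (-(y - x)) := by
      rw [← Real.exp_add]
      ring_nf
    have h2 := Real.one_sub_le_exp_neg (y - x)
    have h3 : Real.exp (-x) ≤ 1 := Real.exp_le_one_iff.2 (by linarith)
    have h4 := Real.exp_pos (-x)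
    nlinarith
  rcases le_total a b with hab | hab
  · exact key ha hab
  · rw [abs_sub_comm, abs_sub_comm a b]
    exact key hb hab

set_option maxHeartbeats 1000000 in
/-- The characteristic function of a bilinear form in two independent i.i.d. families, the first
of them bounded and centred, is nearly Gaussian. -/
theorem exists_norm_integral_rowForm_sub_le {ℓ : ℕ} (u : Fin ℓ → ℝ) {ρ ζ : Measure ℝ}
    [IsProbabilityMeasure ρ] [IsProbabilityMeasure ζ] {B : ℝ} (hB : ∀ᵐ x ∂ρ, |x| ≤ B)
    (h0 : ∫ x, x ∂ρ = 0) (hζ : MemLp id 2 ζ) {K : ℝ} (hK : 0 ≤ K) {ε : ℝ} (hε : 0 < ε) :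
    ∃ δ > 0, ∀ (J : Type) [Fintype J] (θ : ℝ) (ξ : Fin ℓ → J → ℝ) (π : Fin ℓ → Equiv.Perm J),
      0 < θ → θ ≤ δ → Fintype.card J * θ ^ 2 ≤ K → (∀ a p, ξ a p ^ 2 = 1) →
      (∀ p, Function.Injective fun a => π a p) →
      ‖∫ s, ∫ c, Complex.exp ((∑ p, c p * (θ * rowForm u ξ π s p) : ℝ) * Complex.I)
          ∂(Measure.pi fun _ : J => ζ) ∂(Measure.pi fun _ : J => ρ)
        - Real.exp (-(Var[id; ζ] * (θ ^ 2 * (Fintype.card J * (Var[id; ρ] * ∑ a, u a ^ 2)))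
          + Var[id; ρ] * ((∫ x, x ∂ζ) ^ 2 * (θ ^ 2 * ∑ q, colForm u ξ π q ^ 2))) / 2)‖ ≤ ε := by
  have hρ : MemLp id 2 ρ := MemLp.of_bound aestronglyMeasurable_id B (by simpa using hB)
  have hB0 : 0 ≤ B := by
    obtain ⟨x, hx⟩ := hB.exists
    exact (abs_nonneg x).trans hx
  set w : ℝ := Var[id; ζ] with hw
  set v : ℝ := Var[id; ρ] with hv
  set m : ℝ := ∫ x, x ∂ζ with hm
  set U : ℝ := ∑ a, |u a| with hU
  set C : ℝ := B * U with hC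
  set M : ℝ := v * ∑ a, u a ^ 2 with hM
  have hw0 : 0 ≤ w := variance_nonneg _ _
  have hv0 : 0 ≤ v := variance_nonneg _ _
  have hU0 : 0 ≤ U := Finset.sum_nonneg fun _ _ => abs_nonneg _
  have hC0 : 0 ≤ C := mul_nonneg hB0 hU0
  have hM0 : 0 ≤ M := mul_nonneg hv0 (Finset.sum_nonneg fun _ _ => sq_nonneg _)
  obtain ⟨δ₁, hδ₁, H1⟩ := exists_norm_prod_charFun_sub_le hζ
    (ε := ε / (3 * (K * C ^ 2 + 1))) (by positivity)
  obtain ⟨δ₃, hδ₃, H3⟩ := exists_norm_prod_charFun_sub_le hρ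
    (ε := ε / (3 * (m ^ 2 * K * U ^ 2 + 1))) (by positivity)
  set D : ℝ := w * (K * ℓ ^ 2 * C ^ 4 + 1) with hD
  have hD0 : 0 ≤ D := by positivity
  -- The first two bounds make the arguments of `charFun ζ` and `charFun ρ` small; the third absorbs
  -- the law of large numbers error, which is of order `θ`.
  refine ⟨min (δ₁ / (C + 1)) (min (δ₃ / (|m| * U + 1)) (ε / (3 * (D + 1)))), by positivity,
    fun J _ θ ξ π hθ hθδ hJ hξ hπ => ?_⟩
  have hθ1 : θ * (C + 1) ≤ δ₁ := (le_div_iff₀ (by positivity)).1 (hθδ.trans (min_le_left _ _))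
  have hθ3 : θ * (|m| * U + 1) ≤ δ₃ := (le_div_iff₀ (by positivity)).1
    (hθδ.trans ((min_le_right _ _).trans (min_le_left _ _)))
  have hθ2 : θ * (3 * (D + 1)) ≤ ε := (le_div_iff₀ (by positivity)).1
    (hθδ.trans ((min_le_right _ _).trans (min_le_right _ _)))
  set P : Measure (J → ℝ) := Measure.pi fun _ => ρ with hP
  set N : ℝ := (Fintype.card J : ℝ) with hN
  have hN0 : 0 ≤ N := Nat.cast_nonneg _
  simp only [integral_exp_sum_pi]
  let X : (J → ℝ) → ℝ := fun s => ∑ p, θ * rowForm u ξ π s p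
  let Y : (J → ℝ) → ℝ := fun s => ∑ p, (θ * rowForm u ξ π s p) ^ 2
  have hXm : Measurable X := Finset.measurable_sum _ fun p _ => (measurable_rowForm p).const_mul _
  have hYm : Measurable Y :=
    Finset.measurable_sum _ fun p _ => ((measurable_rowForm p).const_mul _).pow_const 2
  have hY0 : ∀ s, 0 ≤ Y s := fun s => Finset.sum_nonneg fun _ _ => sq_nonneg _
  -- `F₀` is the exact conditional characteristic function given `s`, `F₁` its Gaussian
  -- approximation, and `F₂` has the conditional variance replaced by its mean.
  let F₀ : (J → ℝ) → ℂ := fun s => ∏ p, charFun ζ (θ * rowForm u ξ π s p)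
  let F₁ : (J → ℝ) → ℂ := fun s =>
    Complex.exp ((m * X s : ℝ) * Complex.I - (w * Y s / 2 : ℝ))
  let F₂ : (J → ℝ) → ℂ := fun s =>
    Complex.exp ((m * X s : ℝ) * Complex.I - (w * (θ ^ 2 * (N * M)) / 2 : ℝ))
  have hF₀m : Measurable F₀ := Finset.measurable_prod _ fun p _ =>
    measurable_charFun.comp ((measurable_rowForm p).const_mul _)
  have hF₁m : Measurable F₁ := by fun_prop
  have hF₂m : Measurable F₂ := by fun_prop
  have hF₀i : Integrable F₀ P := Integrable.of_bound hF₀m.aestronglyMeasurable 1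
    (.of_forall fun s => by
      simp only [F₀]
      rw [norm_prod]
      exact Finset.prod_le_one (fun _ _ => norm_nonneg _) fun _ _ => norm_charFun_le_one _)
  have hF₁i : Integrable F₁ P := Integrable.of_bound hF₁m.aestronglyMeasurable 1
    (.of_forall fun s => norm_exp_mul_I_sub_le_one _ _ (by have := hY0 s; positivity))
  have hF₂i : Integrable F₂ P := Integrable.of_bound hF₂m.aestronglyMeasurable 1
    (.of_forall fun s => norm_exp_mul_I_sub_le_one _ _ (by positivity))
  have hae := ae_pi_of_ae (J := J) hB
  -- replacing the characteristic functions of the `c p`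
  have S1 : ‖∫ s, F₀ s ∂P - ∫ s, F₁ s ∂P‖ ≤ ε / 3 := by
    rw [← integral_sub hF₀i hF₁i]
    refine (norm_integral_le_of_norm_le_const (C := ε / 3) ?_).trans (by simp)
    filter_upwards [hae] with s hs
    have hx : ∀ p, |θ * rowForm u ξ π s p| ≤ θ * C := fun p => by
      rw [abs_mul, abs_of_pos hθ]
      exact mul_le_mul_of_nonneg_left (abs_rowForm_le hξ hs p) hθ.le
    have h := H1 J (fun p => θ * rowForm u ξ π s p) fun p => (hx p).trans (by nlinarith)
    refine h.trans ?_
    have hsum : ∑ p, (θ * rowForm u ξ π s p) ^ 2 ≤ K * C ^ 2 := by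
      calc ∑ p, (θ * rowForm u ξ π s p) ^ 2 ≤ ∑ _p : J, (θ * C) ^ 2 :=
            Finset.sum_le_sum fun p _ => by
              rw [← sq_abs]
              exact pow_le_pow_left₀ (abs_nonneg _) (hx p) 2
        _ = N * θ ^ 2 * C ^ 2 := by simp [hN]; ring
        _ ≤ K * C ^ 2 := mul_le_mul_of_nonneg_right hJ (sq_nonneg _)
    calc ε / (3 * (K * C ^ 2 + 1)) * ∑ p, (θ * rowForm u ξ π s p) ^ 2
        ≤ ε / (3 * (K * C ^ 2 + 1)) * (K * C ^ 2 + 1) := by gcongr; linarith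
      _ = ε / 3 := by field_simp
  -- the law of large numbers for the conditional variance
  have S2 : ‖∫ s, F₁ s ∂P - ∫ s, F₂ s ∂P‖ ≤ ε / 3 := by
    rw [← integral_sub hF₁i hF₂i]
    let Z : (J → ℝ) → ℝ := fun s => ∑ p, (rowForm u ξ π s p ^ 2 - M)
    have hZm : Measurable Z := Finset.measurable_sum _ fun p _ =>
      ((measurable_rowForm p).pow_const 2).sub_const _
    have hYZ : ∀ s, Y s - θ ^ 2 * (N * M) = θ ^ 2 * Z s := fun s => by
      simp only [Y, Z, Finset.sum_sub_distrib, mul_pow, ← Finset.mul_sum]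
      simp [hN]
      ring
    have hZb : ∀ᵐ s ∂P, |Z s| ≤ N * (C ^ 2 + M) := by
      filter_upwards [hae] with s hs
      refine (Finset.abs_sum_le_sum_abs _ _).trans ?_
      refine (Finset.sum_le_card_nsmul _ _ (C ^ 2 + M) fun p _ => ?_).trans
        (le_of_eq (by simp [hN]; ring))
      have h1 : rowForm u ξ π s p ^ 2 ≤ C ^ 2 := by
        rw [← sq_abs]
        exact pow_le_pow_left₀ (abs_nonneg _) (abs_rowForm_le hξ hs p) 2
      rw [abs_le]
      constructor <;> nlinarith [sq_nonneg (rowForm u ξ π s p)]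
    have hZ2i : Integrable (fun s => Z s ^ 2) P :=
      Integrable.of_bound (hZm.pow_const 2).aestronglyMeasurable ((N * (C ^ 2 + M)) ^ 2) (by
        filter_upwards [hZb] with s hs
        rw [Real.norm_of_nonneg (sq_nonneg _), ← sq_abs]
        exact pow_le_pow_left₀ (abs_nonneg _) hs 2)
    have hbd : ∀ s, ‖F₁ s - F₂ s‖ ≤ w / 4 * (θ ^ 3 * Z s ^ 2 + θ) := by
      intro s
      refine (norm_exp_sub_exp_le _ (by have := hY0 s; positivity) (by positivity)).trans ?_
      rw [show w * Y s / 2 - w * (θ ^ 2 * (N * M)) / 2 = w / 2 * (Y s - θ ^ 2 * (N * M)) by ring,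
        hYZ, abs_mul, abs_mul, abs_of_nonneg (by positivity : 0 ≤ w / 2),
        abs_of_nonneg (sq_nonneg θ)]
      -- This form of AM–GM reduces the error to the second moment of `Z`. That moment is of order
      -- `|J| ≤ K/θ²`, so the resulting bound is of order `θ`.
      have h1 : θ ^ 2 * |Z s| ≤ (θ ^ 3 * Z s ^ 2 + θ) / 2 := by
        have h2 : 0 ≤ θ * (θ * |Z s| - 1) ^ 2 := by positivity
        have h3 : θ * (θ * |Z s| - 1) ^ 2 = θ ^ 3 * |Z s| ^ 2 - 2 * (θ ^ 2 * |Z s|) + θ := by ring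
        rw [h3, sq_abs] at h2
        linarith
      calc w / 2 * (θ ^ 2 * |Z s|) ≤ w / 2 * ((θ ^ 3 * Z s ^ 2 + θ) / 2) := by gcongr
        _ = _ := by ring
    have hbi : Integrable (fun s => w / 4 * (θ ^ 3 * Z s ^ 2 + θ)) P :=
      ((hZ2i.const_mul _).add (integrable_const _)).const_mul _
    refine (norm_integral_le_of_norm_le hbi (.of_forall hbd)).trans ?_
    rw [integral_const_mul, integral_add (hZ2i.const_mul _) (integrable_const _),
      integral_const_mul]
    have hZ2 : ∫ s, Z s ^ 2 ∂P ≤ ℓ ^ 2 * N * C ^ 4 :=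
      integral_sq_sum_rowForm_sq_sub_le hB h0 hξ hπ
    simp only [integral_const, probReal_univ, one_smul]
    have h2 : θ ^ 3 * ∫ s, Z s ^ 2 ∂P ≤ θ * (K * ℓ ^ 2 * C ^ 4) := by
      calc θ ^ 3 * ∫ s, Z s ^ 2 ∂P ≤ θ ^ 3 * (ℓ ^ 2 * N * C ^ 4) := by gcongr
        _ = θ * ((N * θ ^ 2) * (ℓ ^ 2 * C ^ 4)) := by ring
        _ ≤ θ * (K * (ℓ ^ 2 * C ^ 4)) := by gcongr
        _ = _ := by ring
    calc w / 4 * (θ ^ 3 * ∫ s, Z s ^ 2 ∂P + θ) ≤ w / 4 * (θ * (K * ℓ ^ 2 * C ^ 4) + θ) := by gcongr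
      _ = θ * D / 4 := by rw [hD]; ring
      _ ≤ ε / 3 := by
        have h3 : θ * (3 * (D + 1)) = 3 * (θ * D) + 3 * θ := by ring
        have h4 : 0 ≤ θ * D := mul_nonneg hθ.le hD0
        linarith
  -- the linear part
  have S3 : ‖∫ s, F₂ s ∂P - Real.exp (-(w * (θ ^ 2 * (N * M))
      + v * (m ^ 2 * (θ ^ 2 * ∑ q, colForm u ξ π q ^ 2))) / 2)‖ ≤ ε / 3 := by
    -- With the variance frozen, only the linear form `∑ s_q colForm_q` is random, so the integral
    -- factorises over the entries of `s`.
    have e1 : ∫ s, F₂ s ∂P = (Real.exp (-(w * (θ ^ 2 * (N * M)) / 2)) : ℂ)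
        * ∏ q, charFun ρ (m * θ * colForm u ξ π q) := by
      rw [← integral_exp_sum_pi, ← integral_const_mul]
      refine integral_congr_ae (.of_forall fun s => ?_)
      simp only [F₂, X]
      rw [← Finset.mul_sum, sum_rowForm, sub_eq_neg_add, Complex.exp_add]
      congr 1
      · push_cast
        rfl
      · congr 3
        rw [Finset.mul_sum, Finset.mul_sum]
        exact Finset.sum_congr rfl fun q _ => by ring
    have e2 : (Real.exp (-(w * (θ ^ 2 * (N * M))
        + v * (m ^ 2 * (θ ^ 2 * ∑ q, colForm u ξ π q ^ 2))) / 2) : ℂ)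
        = (Real.exp (-(w * (θ ^ 2 * (N * M)) / 2)) : ℂ)
          * Complex.exp (((∫ x, x ∂ρ) * ∑ q, m * θ * colForm u ξ π q : ℝ) * Complex.I
            - (v * (∑ q, (m * θ * colForm u ξ π q) ^ 2) / 2 : ℝ)) := by
      rw [h0, zero_mul]
      simp only [mul_pow, ← Finset.mul_sum]
      push_cast
      rw [← Complex.exp_add]
      congr 1
      ring
    rw [e1, e2, ← mul_sub, norm_mul, Complex.norm_real, Real.norm_of_nonneg (Real.exp_pos _).le]
    have hx : ∀ q, |m * θ * colForm u ξ π q| ≤ |m| * θ * U := fun q => by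
      rw [abs_mul, abs_mul, abs_of_pos hθ]
      exact mul_le_mul_of_nonneg_left (abs_colForm_le hξ q) (by positivity)
    have h := H3 J (fun q => m * θ * colForm u ξ π q) fun q => (hx q).trans (by nlinarith)
    refine (mul_le_of_le_one_left (norm_nonneg _) (Real.exp_le_one_iff.2
      (neg_nonpos.2 (by positivity)))).trans (h.trans ?_)
    have hsum : ∑ q, (m * θ * colForm u ξ π q) ^ 2 ≤ m ^ 2 * K * U ^ 2 := by
      calc ∑ q, (m * θ * colForm u ξ π q) ^ 2 ≤ ∑ _q : J, (|m| * θ * U) ^ 2 :=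
            Finset.sum_le_sum fun q _ => by
              rw [← sq_abs]
              exact pow_le_pow_left₀ (abs_nonneg _) (hx q) 2
        _ = m ^ 2 * (N * θ ^ 2) * U ^ 2 := by
              rw [mul_pow, mul_pow, sq_abs]
              simp [hN]
              ring
        _ ≤ m ^ 2 * K * U ^ 2 := by gcongr
    calc ε / (3 * (m ^ 2 * K * U ^ 2 + 1)) * ∑ q, (m * θ * colForm u ξ π q) ^ 2
        ≤ ε / (3 * (m ^ 2 * K * U ^ 2 + 1)) * (m ^ 2 * K * U ^ 2 + 1) := by gcongr; linarith
      _ = ε / 3 := by field_simp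
  calc _ = ‖(∫ s, F₀ s ∂P - ∫ s, F₁ s ∂P) + (∫ s, F₁ s ∂P - ∫ s, F₂ s ∂P)
        + (∫ s, F₂ s ∂P - Real.exp (-(w * (θ ^ 2 * (N * M))
      + v * (m ^ 2 * (θ ^ 2 * ∑ q, colForm u ξ π q ^ 2))) / 2))‖ := by
        congr 1
        ring
    _ ≤ ε / 3 + ε / 3 + ε / 3 :=
        (norm_add_le _ _).trans (add_le_add ((norm_add_le _ _).trans (add_le_add S1 S2)) S3)
    _ = ε := by ring

end Block

/-! ### Moments of the coefficient laws. -/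

section Distributions

/-- A law on `ℤ` as a law on `ℝ`. -/
noncomputable def castLaw (μ : Measure ℤ) : Measure ℝ := μ.map fun c : ℤ => (c : ℝ)

theorem measurable_intCast_real : Measurable fun c : ℤ => (c : ℝ) := .of_discrete

instance (μ : Measure ℤ) [IsProbabilityMeasure μ] : IsProbabilityMeasure (castLaw μ) :=
  Measure.isProbabilityMeasure_map measurable_intCast_real.aemeasurable

theorem integral_castLaw (μ : Measure ℤ) {f : ℝ → ℝ} (hf : Measurable f) :
    ∫ x, f x ∂(castLaw μ) = ∫ c : ℤ, f c ∂μ :=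
  integral_map measurable_intCast_real.aemeasurable hf.aestronglyMeasurable

theorem memLp_castLaw {μ : Measure ℤ} (h : MemLp (fun c : ℤ => (c : ℝ)) 2 μ) :
    MemLp id 2 (castLaw μ) :=
  (memLp_map_measure_iff aestronglyMeasurable_id measurable_intCast_real.aemeasurable).2 h

theorem variance_castLaw (μ : Measure ℤ) :
    Var[id; castLaw μ] = Var[fun c : ℤ => (c : ℝ); μ] :=
  variance_map aemeasurable_id measurable_intCast_real.aemeasurable

instance (η : ℕ) : IsProbabilityMeasure (centralBinomial η) :=
  Measure.isProbabilityMeasure_map Measurable.of_discrete.aemeasurable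

/-- The binomial weights are values of Bernstein polynomials at `1/2`, whose moment identities then
give mean and variance. -/
theorem integral_castLaw_centralBinomial (η : ℕ) {f : ℝ → ℝ} (hf : Measurable f) :
    ∫ x, f x ∂(castLaw (centralBinomial η)) = ∑ j ∈ Finset.range (2 * η + 1),
      (bernsteinPolynomial ℝ (2 * η) j).eval (1 / 2) * f ((j : ℝ) - η) := by
  rw [integral_castLaw _ hf, centralBinomial, integral_map Measurable.of_discrete.aemeasurable
    Measurable.of_discrete.aestronglyMeasurable, integral_binomial, ← Nat.range_succ_eq_Iic]
  refine Finset.sum_congr rfl fun j _ => ?_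
  simp [bernsteinPolynomial]

theorem integral_id_centralBinomial (η : ℕ) : ∫ x, x ∂(castLaw (centralBinomial η)) = 0 := by
  rw [integral_castLaw_centralBinomial η measurable_id']
  have h1 := congrArg (Polynomial.eval (1 / 2 : ℝ)) (bernsteinPolynomial.sum ℝ (2 * η))
  have h2 := congrArg (Polynomial.eval (1 / 2 : ℝ)) (bernsteinPolynomial.sum_smul ℝ (2 * η))
  simp only [Polynomial.eval_finsetSum, Polynomial.eval_one,
    Polynomial.eval_X, nsmul_eq_mul, Polynomial.eval_mul, Polynomial.eval_natCast] at h1 h2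
  simp only [mul_sub, Finset.sum_sub_distrib, ← Finset.sum_mul]
  simp only [mul_comm] at h1 h2 ⊢
  rw [h1, h2]
  push_cast
  ring

theorem abs_le_ae_centralBinomial (η : ℕ) :
    ∀ᵐ x ∂(castLaw (centralBinomial η)), |x| ≤ (η : ℝ) := by
  have h1 : ∀ᵐ j ∂(binomial (2 * η) ⟨1 / 2, by norm_num, by norm_num⟩), j ≤ 2 * η := by
    exact ae_le_of_hasLaw_binomial (X := id) (P := binomial (2 * η) _) HasLaw.id
  rw [castLaw, centralBinomial, ae_map_iff measurable_intCast_real.aemeasurable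
    (measurableSet_le (by fun_prop) measurable_const : MeasurableSet {x : ℝ | |x| ≤ η}),
    ae_map_iff Measurable.of_discrete.aemeasurable .of_discrete]
  filter_upwards [h1] with j hj
  have h2 : (j : ℝ) ≤ 2 * η := by exact_mod_cast hj
  have h3 : (0 : ℝ) ≤ j := Nat.cast_nonneg _
  push_cast
  rw [abs_le]
  constructor <;> linarith

theorem memLp_centralBinomial (η : ℕ) : MemLp id 2 (castLaw (centralBinomial η)) :=
  MemLp.of_bound aestronglyMeasurable_id η (by simpa using abs_le_ae_centralBinomial η)

theorem variance_centralBinomial (η : ℕ) : Var[id; castLaw (centralBinomial η)] = (η : ℝ) / 2 := by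
  rw [← integral_sq_eq_variance (memLp_centralBinomial η) (integral_id_centralBinomial η),
    integral_castLaw_centralBinomial η (by fun_prop)]
  have h1 := congrArg (Polynomial.eval (1 / 2 : ℝ)) (bernsteinPolynomial.variance ℝ (2 * η))
  simp only [Polynomial.eval_finsetSum, Polynomial.eval_pow, Polynomial.eval_sub,
    Polynomial.eval_one, Polynomial.eval_X, nsmul_eq_mul, Polynomial.eval_mul,
    Polynomial.eval_natCast] at h1
  calc _ = ∑ j ∈ Finset.range (2 * η + 1), (((2 * η : ℕ) : ℝ) * (1 / 2) - j) ^ 2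
        * (bernsteinPolynomial ℝ (2 * η) j).eval (1 / 2) :=
        Finset.sum_congr rfl fun j _ => by push_cast; ring
    _ = (η : ℝ) / 2 := by rw [h1]; push_cast; ring

/-- The law of `-(x + y)` for independent `x`, `y` of laws `μ`, `ν`. -/
noncomputable def negAddLaw (μ ν : Measure ℝ) : Measure ℝ := (μ.prod ν).map fun x => -(x.1 + x.2)

variable {μ ν : Measure ℝ} [IsProbabilityMeasure μ] [IsProbabilityMeasure ν]

theorem measurable_neg_add : Measurable fun x : ℝ × ℝ => -(x.1 + x.2) := by fun_prop

instance : IsProbabilityMeasure (negAddLaw μ ν) :=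
  Measure.isProbabilityMeasure_map measurable_neg_add.aemeasurable

theorem memLp_negAddLaw (hμ : MemLp id 2 μ) (hν : MemLp id 2 ν) : MemLp id 2 (negAddLaw μ ν) :=
  (memLp_map_measure_iff aestronglyMeasurable_id measurable_neg_add.aemeasurable).2
    ((hμ.comp_fst ν).add (hν.comp_snd μ)).neg

theorem integral_id_negAddLaw (hμ : MemLp id 2 μ) (hν : MemLp id 2 ν) :
    ∫ x, x ∂(negAddLaw μ ν) = -(∫ x, x ∂μ + ∫ x, x ∂ν) := by
  rw [negAddLaw, integral_map measurable_neg_add.aemeasurable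
      (f := fun x => x) aestronglyMeasurable_id,
    integral_neg]
  have h := integral_add ((hμ.comp_fst ν).integrable one_le_two)
    ((hν.comp_snd μ).integrable one_le_two)
  simp only [id] at h
  rw [h, integral_fun_fst (fun x : ℝ => x), integral_fun_snd (fun x : ℝ => x)]
  simp

theorem variance_negAddLaw (hμ : MemLp id 2 μ) (hν : MemLp id 2 ν) :
    Var[id; negAddLaw μ ν] = Var[id; μ] + Var[id; ν] := by
  rw [negAddLaw, variance_map aemeasurable_id measurable_neg_add.aemeasurable]
  have h := variance_add_prod hμ hν
  rw [← h]
  exact variance_fun_neg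

end Distributions

/-! ### The noise law as a convolution of independent pieces. -/

section Decomposition

variable {k n : ℕ}

/-- The permutation `(t, j) ↦ (t, i - j)`, with subtraction modulo `n`. -/
def reflect (k : ℕ) {n : ℕ} (i : Fin n) : Equiv.Perm (Fin k × Fin n) :=
  Function.Involutive.toPerm (fun p => (p.1, i - p.2)) fun p => by
    have : NeZero n := ⟨(Nat.zero_lt_of_lt i.isLt).ne'⟩
    simp

theorem reflect_apply (i : Fin n) (p : Fin k × Fin n) : reflect k i p = (p.1, i - p.2) := rfl

/-- The sign of `X^(i-j) X^j` in `ℤ[X]/(X^n+1)`. -/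
def wrapSign (i : Fin n) (p : Fin k × Fin n) : ℝ := if p.2 ≤ i then 1 else -1

/-- The real bilinear form that extends `ringDot`. -/
def bilin (s c : Fin k × Fin n → ℝ) : Fin n → ℝ :=
  fun i => ∑ p, c p * (wrapSign i p * s (reflect k i p))

@[fun_prop]
theorem measurable_bilin :
    Measurable fun x : (Fin k × Fin n → ℝ) × (Fin k × Fin n → ℝ) => bilin x.1 x.2 := by
  unfold bilin
  fun_prop

/-- Integer vectors of ring elements as real vectors. -/
def castVec (u : Fin k → Fin n → ℤ) : Fin k × Fin n → ℝ := fun p => (u p.1 p.2 : ℝ)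

theorem ringDot_cast (u v : Fin k → Fin n → ℤ) (i : Fin n) :
    ((ringDot u v i : ℤ) : ℝ) = bilin (castVec u) (castVec v) i := by
  rw [ringDot, Finset.sum_apply, bilin, Fintype.sum_prod_type]
  push_cast
  refine Finset.sum_congr rfl fun t _ => ?_
  rw [ringMul]
  push_cast
  refine Finset.sum_congr rfl fun j _ => ?_
  simp only [castVec, wrapSign, reflect_apply]
  split_ifs <;> ring

theorem measurePreserving_castVec (μ : Measure ℤ) [IsProbabilityMeasure μ] :
    MeasurePreserving (castVec (k := k) (n := n)) (iidVec k n μ)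
      (Measure.pi fun _ => castLaw μ) where
  measurable := Measurable.of_discrete
  map_eq := by
    refine (Measure.pi_eq fun s hs => ?_).symm
    have h : castVec (k := k) (n := n) ⁻¹' (Set.univ.pi s)
        = Set.univ.pi fun t => Set.univ.pi fun j => (fun c : ℤ => (c : ℝ)) ⁻¹' s (t, j) := by
      ext u
      simp [castVec]
    rw [Measure.map_apply Measurable.of_discrete (MeasurableSet.univ_pi hs), h, iidVec,
      Measure.pi_pi, Fintype.prod_prod_type]
    refine Finset.prod_congr rfl fun t _ => ?_
    rw [Measure.pi_pi]
    refine Finset.prod_congr rfl fun j _ => ?_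
    rw [castLaw, Measure.map_apply measurable_intCast_real (hs _)]

theorem measurePreserving_castPi (μ : Measure ℤ) [IsProbabilityMeasure μ] :
    MeasurePreserving (fun (u : Fin n → ℤ) i => (u i : ℝ)) (Measure.pi fun _ => μ)
      (Measure.pi fun _ => castLaw μ) :=
  measurePreserving_pi (fun _ => μ) (fun _ => castLaw μ) (f := fun _ c => (c : ℝ))
    fun _ => ⟨measurable_intCast_real, rfl⟩

theorem measurePreserving_neg_add_pi {J : Type*} [Fintype J] (μ ν : Measure ℝ)
    [IsProbabilityMeasure μ] [IsProbabilityMeasure ν] :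
    MeasurePreserving (fun x : (J → ℝ) × (J → ℝ) => -(x.1 + x.2))
      ((Measure.pi fun _ => μ).prod (Measure.pi fun _ => ν))
      (Measure.pi fun _ => negAddLaw μ ν) := by
  have h1 := (measurePreserving_arrowProdEquivProdArrow ℝ ℝ J (fun _ => μ) fun _ => ν).symm
  have h2 : MeasurePreserving (fun (x : J → ℝ × ℝ) j => -((x j).1 + (x j).2))
      (Measure.pi fun _ => μ.prod ν) (Measure.pi fun _ => negAddLaw μ ν) :=
    measurePreserving_pi (fun _ => μ.prod ν) (fun _ => negAddLaw μ ν)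
      (f := fun _ x => -(x.1 + x.2)) fun _ => ⟨measurable_neg_add, rfl⟩
  exact h2.comp h1

/-- The law of `bilin s c` for independent `s`, `c` with i.i.d. coordinates of laws `ρ`, `ζ`. -/
noncomputable def bilinLaw (k n : ℕ) (ρ ζ : Measure ℝ) : Measure (Fin n → ℝ) :=
  ((Measure.pi fun _ : Fin k × Fin n => ρ).prod (Measure.pi fun _ : Fin k × Fin n => ζ)).map
    fun x => bilin x.1 x.2

instance (ρ ζ : Measure ℝ) [IsProbabilityMeasure ρ] [IsProbabilityMeasure ζ] :
    IsProbabilityMeasure (bilinLaw k n ρ ζ) :=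
  Measure.isProbabilityMeasure_map measurable_bilin.aemeasurable

/-- Peels one independent summand off a nested product law. -/
theorem map_add_prod_assoc {α β γ V : Type*} [MeasurableSpace α] [MeasurableSpace β]
    [MeasurableSpace γ] [MeasurableSpace V] [AddMonoid V] [MeasurableAdd₂ V] (μ : Measure α)
    (ν : Measure β) (κ : Measure γ) [IsProbabilityMeasure μ] [IsProbabilityMeasure ν]
    [IsProbabilityMeasure κ] {f : α × β → V} {g : γ → V} (hf : Measurable f) (hg : Measurable g) :
    (μ.prod (ν.prod κ)).map (fun x => f (x.1, x.2.1) + g x.2.2)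
      = ((μ.prod ν).map f).conv (κ.map g) := by
  rw [Measure.conv, Measure.map_prod_map _ _ hf hg,
    ← (measurePreserving_prodAssoc μ ν κ).map_eq,
    Measure.map_map (by fun_prop) (by fun_prop),
    Measure.map_map (by fun_prop) (by fun_prop)]
  rfl

/-- The part of the noise that does not come from `c_v`. -/
noncomputable def smoothNoiseLaw (k η₁ η₂ : ℕ) (ψ : Measure ℤ) (n : ℕ) : Measure (Fin n → ℝ) :=
  (bilinLaw k n (castLaw (centralBinomial η₁)) (castLaw (centralBinomial η₁))).conv
    ((bilinLaw k n (castLaw (centralBinomial η₁))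
        (negAddLaw (castLaw (centralBinomial η₂)) (castLaw ψ))).conv
      (Measure.pi fun _ => castLaw (centralBinomial η₂)))

/-- The minus sign and the sum `e₁ + c_u` are absorbed into `negAddLaw`, so that both products are
instances of `bilinLaw`. -/
theorem noiseLaw_eq_conv (k η₁ η₂ n : ℕ) (ψ : Measure ℤ) [IsProbabilityMeasure ψ] (b : ℤ)
    [IsProbabilityMeasure (discreteUniform b)] :
    noiseLaw k η₁ η₂ ψ b n = (smoothNoiseLaw k η₁ η₂ ψ n).conv
      (Measure.pi fun _ => castLaw (discreteUniform b)) := by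
  set β₁ := centralBinomial η₁
  set β₂ := centralBinomial η₂
  set υ := discreteUniform b
  let J := Fin k × Fin n
  let p₁ : Measure (J → ℝ) := Measure.pi fun _ => castLaw β₁
  let p₂ : Measure (J → ℝ) := Measure.pi fun _ => castLaw β₂
  let p₃ : Measure (J → ℝ) := Measure.pi fun _ => castLaw ψ
  let pζ : Measure (J → ℝ) := Measure.pi fun _ => negAddLaw (castLaw β₂) (castLaw ψ)
  let q₂ : Measure (Fin n → ℝ) := Measure.pi fun _ => castLaw β₂
  let qU : Measure (Fin n → ℝ) := Measure.pi fun _ => castLaw υ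
  let J1 := J → ℝ
  have hcast := (measurePreserving_castVec (k := k) (n := n) β₁).prod
    ((measurePreserving_castVec (k := k) (n := n) β₁).prod
      ((measurePreserving_castVec (k := k) (n := n) β₁).prod
        ((measurePreserving_castVec (k := k) (n := n) β₂).prod
          ((measurePreserving_castVec (k := k) (n := n) ψ).prod
            ((measurePreserving_castPi (n := n) β₂).prod (measurePreserving_castPi (n := n) υ))))))
  have hassoc : MeasurePreserving
      (fun x : J1 × J1 × (Fin n → ℝ) × (Fin n → ℝ) => (-(x.1 + x.2.1), x.2.2))
      (p₂.prod (p₃.prod (q₂.prod qU))) (pζ.prod (q₂.prod qU)) :=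
    ((measurePreserving_neg_add_pi (castLaw β₂) (castLaw ψ)).prod
      (MeasurePreserving.id (q₂.prod qU))).comp
      (measurePreserving_prodAssoc p₂ p₃ (q₂.prod qU)).symm
  have hmerge := (MeasurePreserving.id p₁).prod ((MeasurePreserving.id p₁).prod
    ((MeasurePreserving.id p₁).prod hassoc))
  have hall := hmerge.comp hcast
  let F : J1 × J1 × J1 × J1 × (Fin n → ℝ) × (Fin n → ℝ) → Fin n → ℝ :=
    fun x => bilin x.1 x.2.1 + (bilin x.2.2.1 x.2.2.2.1 + (x.2.2.2.2.1 + x.2.2.2.2.2))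
  have hg1 : Measurable fun x : (Fin n → ℝ) × (Fin n → ℝ) => x.1 + x.2 := by fun_prop
  have hg2 : Measurable fun x : J1 × J1 × (Fin n → ℝ) × (Fin n → ℝ) =>
      bilin x.1 x.2.1 + (x.2.2.1 + x.2.2.2) :=
    (measurable_bilin.comp (measurable_fst.prodMk measurable_snd.fst)).add
      (hg1.comp measurable_snd.snd)
  have hF : Measurable F :=
    (measurable_bilin.comp (measurable_fst.prodMk measurable_snd.fst)).add
      (hg2.comp measurable_snd.snd)
  have e1 : noiseLaw k η₁ η₂ ψ b n = (p₁.prod (p₁.prod (p₁.prod (pζ.prod (q₂.prod qU))))).map F := by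
    rw [← hall.map_eq, Measure.map_map hF hall.measurable]
    refine congrArg (fun f => Measure.map f _) ?_
    ext ⟨e, r, s, e₁, cu, e₂, cv⟩ i
    simp only [decodingNoise, F, Function.comp_apply, Prod.map, id, Pi.add_apply, Pi.sub_apply]
    push_cast
    rw [ringDot_cast, ringDot_cast]
    have hneg : bilin (castVec s) (-(castVec e₁ + castVec cu)) i
        = -bilin (castVec s) (castVec (e₁ + cu)) i := by
      simp only [bilin, castVec, Pi.neg_apply, Pi.add_apply, ← Finset.sum_neg_distrib]
      refine Finset.sum_congr rfl fun p _ => ?_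
      push_cast
      ring
    rw [hneg]
    ring
  rw [e1, map_add_prod_assoc p₁ p₁ _ measurable_bilin hg2, map_add_prod_assoc p₁ pζ _
    measurable_bilin hg1, smoothNoiseLaw, Measure.conv_assoc, Measure.conv_assoc]
  rfl

end Decomposition

/-! ### Means and covariances under convolution. -/

section MeanCov

variable {n : ℕ}

/-- `P` has finite second moments, mean `0` and covariance matrix `C`. -/
structure IsCentredCov (P : Measure (Fin n → ℝ)) (C : Matrix (Fin n) (Fin n) ℝ) : Prop where
  memLp : ∀ i, MemLp (fun x : Fin n → ℝ => x i) 2 P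
  mean : ∀ i, ∫ x, x i ∂P = 0
  cov : ∀ i j, covariance (fun x => x i) (fun x => x j) P = C i j

variable {P Q : Measure (Fin n → ℝ)} [IsProbabilityMeasure P] [IsProbabilityMeasure Q]

theorem measurable_add_pi :
    Measurable fun x : (Fin n → ℝ) × (Fin n → ℝ) => x.1 + x.2 := by fun_prop

theorem memLp_conv (hP : ∀ i, MemLp (fun x : Fin n → ℝ => x i) 2 P)
    (hQ : ∀ i, MemLp (fun x : Fin n → ℝ => x i) 2 Q) (i : Fin n) :
    MemLp (fun x : Fin n → ℝ => x i) 2 (P.conv Q) := by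
  rw [Measure.conv, memLp_map_measure_iff (measurable_pi_apply i).aestronglyMeasurable
    measurable_add_pi.aemeasurable]
  exact ((hP i).comp_fst Q).add ((hQ i).comp_snd P)

theorem integral_eval_conv (hP : ∀ i, MemLp (fun x : Fin n → ℝ => x i) 2 P)
    (hQ : ∀ i, MemLp (fun x : Fin n → ℝ => x i) 2 Q) (i : Fin n) :
    ∫ x, x i ∂(P.conv Q) = ∫ x, x i ∂P + ∫ x, x i ∂Q := by
  rw [Measure.conv, integral_map measurable_add_pi.aemeasurable
    (measurable_pi_apply i).aestronglyMeasurable]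
  simp only [Pi.add_apply]
  rw [integral_add (((hP i).comp_fst Q).integrable one_le_two)
      (((hQ i).comp_snd P).integrable one_le_two),
    integral_fun_fst (fun x : Fin n → ℝ => x i), integral_fun_snd (fun x : Fin n → ℝ => x i)]
  simp

theorem covariance_fst_fst_prod {Ω Ω' : Type*} [MeasurableSpace Ω] [MeasurableSpace Ω']
    (μ : Measure Ω) (ν : Measure Ω') [IsProbabilityMeasure μ] [IsProbabilityMeasure ν] {X Y : Ω → ℝ}
    (hX : Measurable X) (hY : Measurable Y) :
    covariance (fun x => X x.1) (fun x => Y x.1) (μ.prod ν) = covariance X Y μ := by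
  have h := covariance_map (μ := μ.prod ν) (Z := Prod.fst) (X := X) (Y := Y)
    hX.aestronglyMeasurable hY.aestronglyMeasurable measurable_fst.aemeasurable
  rw [Measure.map_fst_prod, measure_univ, one_smul] at h
  exact h.symm

theorem covariance_snd_snd_prod {Ω Ω' : Type*} [MeasurableSpace Ω] [MeasurableSpace Ω']
    (μ : Measure Ω) (ν : Measure Ω') [IsProbabilityMeasure μ] [IsProbabilityMeasure ν] {X Y : Ω' → ℝ}
    (hX : Measurable X) (hY : Measurable Y) :
    covariance (fun x => X x.2) (fun x => Y x.2) (μ.prod ν) = covariance X Y ν := by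
  have h := covariance_map (μ := μ.prod ν) (Z := Prod.snd) (X := X) (Y := Y)
    hX.aestronglyMeasurable hY.aestronglyMeasurable measurable_snd.aemeasurable
  rw [Measure.map_snd_prod, measure_univ, one_smul] at h
  exact h.symm

theorem covariance_eval_conv (hP : ∀ i, MemLp (fun x : Fin n → ℝ => x i) 2 P)
    (hQ : ∀ i, MemLp (fun x : Fin n → ℝ => x i) 2 Q) (i j : Fin n) :
    covariance (fun x => x i) (fun x => x j) (P.conv Q)
      = covariance (fun x => x i) (fun x => x j) P
        + covariance (fun x => x i) (fun x => x j) Q := by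
  have hm : ∀ i, Measurable fun x : Fin n → ℝ => x i := measurable_pi_apply
  rw [Measure.conv, covariance_map_fun (hm i).aestronglyMeasurable (hm j).aestronglyMeasurable
    measurable_add_pi.aemeasurable]
  have h1 : ∀ i, MemLp (fun x : (Fin n → ℝ) × (Fin n → ℝ) => x.1 i) 2 (P.prod Q) :=
    fun i => (hP i).comp_fst Q
  have h2 : ∀ i, MemLp (fun x : (Fin n → ℝ) × (Fin n → ℝ) => x.2 i) 2 (P.prod Q) :=
    fun i => (hQ i).comp_snd P
  have e : ∀ i, (fun x : (Fin n → ℝ) × (Fin n → ℝ) => (x.1 + x.2) i)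
      = (fun x => x.1 i) + fun x => x.2 i := fun i => rfl
  rw [e, e, covariance_add_left (h1 i) (h2 i) ((h1 j).add (h2 j)),
    covariance_add_right (h1 i) (h1 j) (h2 j), covariance_add_right (h2 i) (h1 j) (h2 j),
    covariance_fst_fst_prod P Q (hm i) (hm j), covariance_snd_snd_prod P Q (hm i) (hm j),
    covariance_fst_snd_prod (hP i) (hQ j),
    covariance_comm (fun x : (Fin n → ℝ) × (Fin n → ℝ) => x.2 i), covariance_fst_snd_prod (hP j) (hQ i)]
  ring

theorem IsCentredCov.conv {C D : Matrix (Fin n) (Fin n) ℝ} (hP : IsCentredCov P C)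
    (hQ : IsCentredCov Q D) : IsCentredCov (P.conv Q) (C + D) where
  memLp := memLp_conv hP.memLp hQ.memLp
  mean i := by rw [integral_eval_conv hP.memLp hQ.memLp, hP.mean, hQ.mean, add_zero]
  cov i j := by rw [covariance_eval_conv hP.memLp hQ.memLp, hP.cov, hQ.cov, Matrix.add_apply]

theorem IsCentredCov.sameMeanCov_conv {C : Matrix (Fin n) (Fin n) ℝ} (hP : IsCentredCov P C)
    (hQ : IsCentredCov Q C) {U : Measure (Fin n → ℝ)} [IsProbabilityMeasure U]
    (hU : ∀ i, MemLp (fun x : Fin n → ℝ => x i) 2 U) : SameMeanCov (P.conv U) (Q.conv U) := by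
  refine ⟨fun i => ⟨memLp_conv hP.memLp hU i, memLp_conv hQ.memLp hU i⟩, fun i => ?_,
    fun i j => ?_⟩
  · rw [integral_eval_conv hP.memLp hU, integral_eval_conv hQ.memLp hU, hP.mean, hQ.mean]
  · rw [covariance_eval_conv hP.memLp hU, covariance_eval_conv hQ.memLp hU, hP.cov, hQ.cov]

theorem isCentredCov_pi {μ : Measure ℝ} [IsProbabilityMeasure μ] (h2 : MemLp id 2 μ)
    (h0 : ∫ x, x ∂μ = 0) :
    IsCentredCov (Measure.pi fun _ : Fin n => μ) (Var[id; μ] • 1) where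
  memLp := memLp_eval_pi h2
  mean i := by rw [integral_eval_pi μ i (fun x => x) measurable_id, h0]
  cov i j := by
    rw [covariance_eq_sub (memLp_eval_pi h2 i) (memLp_eval_pi h2 j),
      integral_eval_pi μ i (fun x => x) measurable_id]
    simp only [Pi.mul_apply]
    rw [integral_eval_mul_eval_pi, h0, integral_sq_eq_variance h2 h0]
    simp [Matrix.one_apply]

theorem isCentredCov_multivariateGaussian {S : Matrix (Fin n) (Fin n) ℝ} (hS : S.PosSemidef) :
    IsCentredCov ((multivariateGaussian 0 S).map fun x => (fun i => x i)) S := by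
  have hm : Measurable fun (x : EuclideanSpace ℝ (Fin n)) => (fun i => x i) := by fun_prop
  have h2 : ∀ i, MemLp (fun x : EuclideanSpace ℝ (Fin n) => x i) 2 (multivariateGaussian 0 S) :=
    fun i => (EuclideanSpace.proj i : EuclideanSpace ℝ (Fin n) →L[ℝ] ℝ).comp_memLp'
      (IsGaussian.memLp_two_id (μ := multivariateGaussian 0 S))
  refine ⟨fun i => ?_, fun i => ?_, fun i j => ?_⟩
  · rw [memLp_map_measure_iff (measurable_pi_apply i).aestronglyMeasurable hm.aemeasurable]
    exact h2 i
  · rw [integral_map hm.aemeasurable (measurable_pi_apply i).aestronglyMeasurable]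
    have h := (EuclideanSpace.proj i : EuclideanSpace ℝ (Fin n) →L[ℝ] ℝ).integral_comp_comm
      (IsGaussian.integrable_id (μ := multivariateGaussian 0 S))
    simp only [id, integral_id_multivariateGaussian] at h
    simpa using h
  · rw [covariance_map_fun (measurable_pi_apply i).aestronglyMeasurable
      (measurable_pi_apply j).aestronglyMeasurable hm.aemeasurable]
    exact covariance_eval_multivariateGaussian hS i j

end MeanCov

/-! ### Combinatorics of the signs modulo `X^n + 1`. -/

section Overlap

variable {k n : ℕ}

/-- Without wrap-around `i - j` is the ordinary difference; with it, the value is `i + n - j > i`.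
-/
theorem sub_le_self_iff_fin (i j : Fin n) : i - j ≤ i ↔ j ≤ i := by
  constructor
  · intro h
    by_contra! hc
    have h1 : ((i - j : Fin n) : ℕ) = (n - j + i) % n := Fin.val_sub _ _
    have h2 : (i : ℕ) < j := hc
    have h3 : ((i - j : Fin n) : ℕ) ≤ i := h
    rw [Nat.mod_eq_of_lt (by omega)] at h1
    omega
  · intro h
    have h1 := Fin.sub_val_of_le h
    have h2 : ((i - j : Fin n) : ℕ) ≤ i := by omega
    exact h2

/-- The sign is symmetric in the two factors, since `j` and `i - j` wrap around together. -/
theorem wrapSign_reflect (i : Fin n) (p : Fin k × Fin n) :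
    wrapSign i (reflect k i p) = wrapSign i p := by
  simp only [wrapSign, reflect_apply, sub_le_self_iff_fin]

theorem reflect_symm (i : Fin n) : (reflect k i).symm = reflect k i := rfl

theorem reflect_reflect (i : Fin n) (p : Fin k × Fin n) : reflect k i (reflect k i p) = p :=
  (reflect k i).apply_symm_apply p

theorem wrapSign_sq (i : Fin n) (p : Fin k × Fin n) : wrapSign i p ^ 2 = 1 := by
  unfold wrapSign
  split_ifs <;> norm_num

theorem reflect_injective (p : Fin k × Fin n) : Function.Injective fun i => reflect k i p := by
  intro i i' h
  have : NeZero n := ⟨(Nat.zero_lt_of_lt i.isLt).ne'⟩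
  simpa [reflect_apply] using h

/-- The two signs differ exactly at the `|i - i'|` indices above the smaller and up to the larger of
`i`, `i'`. -/
theorem sum_sign_mul_sign (i i' : Fin n) :
    ∑ j : Fin n, ((if j ≤ i then 1 else -1) * (if j ≤ i' then 1 else -1) : ℝ)
      = overlap n i i' := by
  have key : ∀ i i' : Fin n, i ≤ i' →
      ∑ j : Fin n, ((if j ≤ i then 1 else -1) * (if j ≤ i' then 1 else -1) : ℝ)
        = overlap n i i' := by
    intro i i' h
    have hle : ((i : ℕ) : ℝ) ≤ ((i' : ℕ) : ℝ) := by exact_mod_cast h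
    have h1 : ∀ j : Fin n, ((if j ≤ i then 1 else -1) * (if j ≤ i' then 1 else -1) : ℝ)
        = 1 - 2 * (if j ∈ Finset.Ioc i i' then 1 else 0) := by
      intro j
      by_cases h1 : j ≤ i
      · simp [h1, h1.trans h, not_lt.2 h1]
      · by_cases h2 : j ≤ i'
        · simp [h2, not_le.1 h1, not_le.2 (not_le.1 h1)]
          norm_num
        · simp [h1, h2]
    rw [Finset.sum_congr rfl fun j _ => h1 j, Finset.sum_sub_distrib, ← Finset.mul_sum,
      Finset.sum_ite_mem, Finset.univ_inter]
    simp only [Finset.sum_const, Finset.card_univ, Fintype.card_fin, Fin.card_Ioc, nsmul_eq_mul,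
      mul_one, overlap, Matrix.of_apply]
    rw [Nat.cast_sub h, abs_sub_comm, abs_of_nonneg (sub_nonneg.2 hle)]
  rcases le_total i i' with h | h
  · exact key i i' h
  · have h1 := key i' i h
    have h2 : overlap n i i' = overlap n i' i := by
      simp only [overlap, Matrix.of_apply, abs_sub_comm]
    rw [h2, ← h1]
    exact Finset.sum_congr rfl fun j _ => mul_comm _ _

theorem sum_wrapSign_mul_wrapSign (k : ℕ) (i i' : Fin n) :
    ∑ p : Fin k × Fin n, wrapSign i p * wrapSign i' p = k * overlap n i i' := by
  rw [Fintype.sum_prod_type]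
  simp only [wrapSign, sum_sign_mul_sign]
  simp

/-- It is the Gram matrix of the sign vectors. -/
theorem posSemidef_overlap (n : ℕ) : (overlap n).PosSemidef := by
  have h := Matrix.posSemidef_conjTranspose_mul_self
    (Matrix.of fun j i : Fin n => (if j ≤ i then 1 else -1 : ℝ))
  convert h using 1
  ext i i'
  rw [← sum_sign_mul_sign]
  simp [Matrix.mul_apply]

end Overlap

/-! ### Covariance of the bilinear form. -/

section BilinCov

variable {k n : ℕ} {ρ ζ : Measure ℝ} [IsProbabilityMeasure ρ] [IsProbabilityMeasure ζ]

theorem memLp_mul_prod {Ω Ω' : Type*} [MeasurableSpace Ω] [MeasurableSpace Ω']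
    {μ : Measure Ω} {ν : Measure Ω'} [IsProbabilityMeasure μ] [IsProbabilityMeasure ν]
    {X : Ω → ℝ} {Y : Ω' → ℝ} (hX : MemLp X 2 μ) (hY : MemLp Y 2 ν) :
    MemLp (fun x : Ω × Ω' => X x.1 * Y x.2) 2 (μ.prod ν) := by
  rw [memLp_two_iff_integrable_sq (f := fun x : Ω × Ω' => X x.1 * Y x.2)
    ((hX.comp_fst ν).aestronglyMeasurable.mul (hY.comp_snd μ).aestronglyMeasurable)]
  simp only [mul_pow]
  exact hX.integrable_sq.mul_prod hY.integrable_sq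

/-- As `ρ` is centred, a pair `p`, `p'` contributes only if both terms use the same entry of `s`,
which determines `p'` from `p`. Then `p' = p` exactly when `i = i'`. So the variance of `ζ` enters
on the diagonal only, while its squared mean multiplies the sum of sign products. -/
theorem isCentredCov_bilinLaw (hρ : MemLp id 2 ρ) (hρ0 : ∫ x, x ∂ρ = 0) (hζ : MemLp id 2 ζ) :
    IsCentredCov (bilinLaw k n ρ ζ) ((k * n * Var[id; ρ] * Var[id; ζ]) • 1
      + (k * Var[id; ρ] * (∫ x, x ∂ζ) ^ 2) • overlap n) := by
  set R : Measure (Fin k × Fin n → ℝ) := Measure.pi fun _ => ρ with hR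
  set Z : Measure (Fin k × Fin n → ℝ) := Measure.pi fun _ => ζ with hZ
  have hterm : ∀ i p, MemLp (fun x : (Fin k × Fin n → ℝ) × (Fin k × Fin n → ℝ) =>
      x.2 p * (wrapSign i p * x.1 (reflect k i p))) 2 (R.prod Z) := by
    intro i p
    have h := (memLp_mul_prod (memLp_eval_pi hρ (reflect k i p)) (memLp_eval_pi hζ p)).const_mul
      (wrapSign i p)
    refine h.ae_eq (.of_forall fun x => ?_)
    simp only
    ring
  have hmem : ∀ i, MemLp (fun x : (Fin k × Fin n → ℝ) × (Fin k × Fin n → ℝ) =>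
      bilin x.1 x.2 i) 2 (R.prod Z) := fun i => memLp_finsetSum _ fun p _ => hterm i p
  have hmem' : ∀ i, MemLp (fun x : Fin n → ℝ => x i) 2 (bilinLaw k n ρ ζ) := fun i =>
    (memLp_map_measure_iff (measurable_pi_apply i).aestronglyMeasurable
      measurable_bilin.aemeasurable).2 (hmem i)
  have hmean : ∀ i, ∫ x, x i ∂(bilinLaw k n ρ ζ) = 0 := by
    intro i
    rw [bilinLaw, integral_map measurable_bilin.aemeasurable
      (measurable_pi_apply i).aestronglyMeasurable]
    simp only [bilin]
    rw [integral_finsetSum _ fun p _ => (hterm i p).integrable one_le_two]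
    refine Finset.sum_eq_zero fun p _ => ?_
    have h := integral_prod_mul (μ := R) (ν := Z) (fun s => wrapSign i p * s (reflect k i p))
      fun c => c p
    rw [integral_const_mul, integral_eval_pi ρ _ (fun x => x) measurable_id, hρ0, mul_zero,
      zero_mul] at h
    rw [← h]
    exact integral_congr_ae (.of_forall fun x => mul_comm _ _)
  refine ⟨hmem', hmean, fun i i' => ?_⟩
  rw [covariance_eq_sub (hmem' i) (hmem' i'), hmean, zero_mul, sub_zero]
  simp only [Pi.mul_apply]
  have hmul : Measurable fun x : Fin n → ℝ => x i * x i' :=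
    (measurable_pi_apply i).mul (measurable_pi_apply i')
  rw [bilinLaw, integral_map measurable_bilin.aemeasurable hmul.aestronglyMeasurable]
  have hexp : ∀ x : (Fin k × Fin n → ℝ) × (Fin k × Fin n → ℝ), bilin x.1 x.2 i * bilin x.1 x.2 i'
      = ∑ p, ∑ p', (x.2 p * (wrapSign i p * x.1 (reflect k i p)))
        * (x.2 p' * (wrapSign i' p' * x.1 (reflect k i' p'))) := fun x => by
    rw [bilin, bilin, Finset.sum_mul_sum]
  simp only [hexp]
  have hint : ∀ p p', Integrable (fun x : (Fin k × Fin n → ℝ) × (Fin k × Fin n → ℝ) =>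
      (x.2 p * (wrapSign i p * x.1 (reflect k i p)))
        * (x.2 p' * (wrapSign i' p' * x.1 (reflect k i' p')))) (R.prod Z) := fun p p' =>
    (hterm i p).integrable_mul (hterm i' p')
  rw [integral_finsetSum _ fun p _ => integrable_finsetSum _ fun p' _ => hint p p']
  have hval : ∀ p p', ∫ x : (Fin k × Fin n → ℝ) × (Fin k × Fin n → ℝ),
      (x.2 p * (wrapSign i p * x.1 (reflect k i p)))
        * (x.2 p' * (wrapSign i' p' * x.1 (reflect k i' p'))) ∂(R.prod Z)
      = wrapSign i p * wrapSign i' p'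
        * (if p' = reflect k i' (reflect k i p) then Var[id; ρ] else 0)
        * ((if p = p' then Var[id; ζ] else 0) + (∫ x, x ∂ζ) ^ 2) := by
    intro p p'
    have h := integral_prod_mul (μ := R) (ν := Z)
      (fun s => wrapSign i p * wrapSign i' p' * (s (reflect k i p) * s (reflect k i' p')))
      fun c => c p * c p'
    rw [integral_const_mul, integral_eval_mul_eval_pi, integral_eval_mul_eval_pi, hρ0,
      integral_sq_eq_variance hρ hρ0] at h
    have hv : ∫ x, x ^ 2 ∂ζ = Var[id; ζ] + (∫ x, x ∂ζ) ^ 2 := by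
      rw [variance_eq_sub hζ]
      simp
    have hc : (reflect k i p = reflect k i' p') ↔ p' = reflect k i' (reflect k i p) :=
      ⟨fun h => by rw [h, reflect_reflect], fun h => by rw [h, reflect_reflect]⟩
    have hr : (if p = p' then Var[id; ζ] else 0) + (∫ x, x ∂ζ) ^ 2
        = if p = p' then ∫ x, x ^ 2 ∂ζ else (∫ x, x ∂ζ) ^ 2 := by
      split_ifs
      · rw [hv]
      · simp
    simp only [hc, ne_eq, OfNat.ofNat_ne_zero, not_false_eq_true, zero_pow] at h
    rw [hr, ← h]
    refine integral_congr_ae (.of_forall fun x => ?_)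
    simp only
    ring
  have hsum : ∀ p, ∫ x : (Fin k × Fin n → ℝ) × (Fin k × Fin n → ℝ), ∑ p',
      (x.2 p * (wrapSign i p * x.1 (reflect k i p)))
        * (x.2 p' * (wrapSign i' p' * x.1 (reflect k i' p'))) ∂(R.prod Z)
      = Var[id; ρ] * Var[id; ζ] * (if i = i' then 1 else 0)
        + Var[id; ρ] * (∫ x, x ∂ζ) ^ 2
          * (wrapSign i (reflect k i p) * wrapSign i' (reflect k i p)) := by
    intro p
    rw [integral_finsetSum _ fun p' _ => hint p p', Finset.sum_congr rfl fun p' _ => hval p p',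
      Finset.sum_eq_single (reflect k i' (reflect k i p))
        (fun p' _ hp' => by rw [if_neg hp']; ring) (by simp),
      if_pos rfl, wrapSign_reflect, wrapSign_reflect]
    by_cases hii : i = i'
    · subst hii
      rw [reflect_reflect, if_pos rfl, if_pos rfl, wrapSign_reflect]
      linear_combination (Var[id; ρ] * Var[id; ζ]) * wrapSign_sq i p
    · rw [if_neg hii, if_neg]
      · ring
      · intro hp
        apply hii
        apply reflect_injective p
        simp only
        rw [← reflect_reflect i' (reflect k i p), ← hp]
  rw [Finset.sum_congr rfl fun p _ => hsum p, Finset.sum_add_distrib, ← Finset.mul_sum, ← Finset.mul_sum,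
    Equiv.sum_comp (reflect k i) fun q => wrapSign i q * wrapSign i' q, sum_wrapSign_mul_wrapSign]
  simp only [Finset.sum_const, Finset.card_univ, Fintype.card_prod, Fintype.card_fin,
    nsmul_eq_mul, Matrix.add_apply, Matrix.smul_apply, Matrix.one_apply, smul_eq_mul]
  push_cast
  ring

end BilinCov

/-! ### Absolute continuity of the Gaussian limit laws. -/

section AbsolutelyContinuous

theorem pi_absolutelyContinuous {μ ν : Measure ℝ} [SigmaFinite μ] [SigmaFinite ν] (h : μ ≪ ν) :
    ∀ ℓ : ℕ, (Measure.pi fun _ : Fin ℓ => μ) ≪ Measure.pi fun _ : Fin ℓ => ν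
  | 0 => by
    rw [Measure.pi_of_empty (fun _ : Fin 0 => μ), Measure.pi_of_empty (fun _ : Fin 0 => ν)]
  | ℓ + 1 => by
    have h1 := (measurePreserving_piFinSuccAbove (fun _ : Fin (ℓ + 1) => μ) 0).symm
    have h2 := (measurePreserving_piFinSuccAbove (fun _ : Fin (ℓ + 1) => ν) 0).symm
    rw [← h1.map_eq, ← h2.map_eq]
    exact (h.prod (pi_absolutelyContinuous h ℓ)).map h1.measurable

theorem stdGaussian_absolutelyContinuous (ℓ : ℕ) :
    stdGaussian (EuclideanSpace ℝ (Fin ℓ)) ≪ volume := by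
  rw [← map_pi_eq_stdGaussian, ← (PiLp.volume_preserving_toLp (Fin ℓ)).map_eq]
  exact (pi_absolutelyContinuous (gaussianReal_absolutelyContinuous 0 one_ne_zero) ℓ).map
    (PiLp.volume_preserving_toLp (Fin ℓ)).measurable

/-- The Gaussian law with covariance `c • 1 + S`, as a convolution. -/
noncomputable def gaussianConv {ℓ : ℕ} (c : ℝ) (S : Matrix (Fin ℓ) (Fin ℓ) ℝ) :
    Measure (EuclideanSpace ℝ (Fin ℓ)) :=
  (multivariateGaussian 0 S).conv
    ((stdGaussian (EuclideanSpace ℝ (Fin ℓ))).map fun x => √c • x)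

instance {ℓ : ℕ} (c : ℝ) (S : Matrix (Fin ℓ) (Fin ℓ) ℝ) :
    IsProbabilityMeasure (gaussianConv c S) := by
  have : IsProbabilityMeasure ((stdGaussian (EuclideanSpace ℝ (Fin ℓ))).map fun x => √c • x) :=
    Measure.isProbabilityMeasure_map (by fun_prop)
  unfold gaussianConv
  infer_instance

/-- One absolutely continuous factor suffices, so `S` may be degenerate. -/
theorem gaussianConv_absolutelyContinuous {ℓ : ℕ} {c : ℝ} (hc : 0 < c)
    (S : Matrix (Fin ℓ) (Fin ℓ) ℝ) : gaussianConv c S ≪ volume := by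
  refine Measure.conv_absolutelyContinuous ?_
  have h := (stdGaussian_absolutelyContinuous ℓ).map
    (f := fun x => √c • x) (measurable_const_smul _)
  refine h.trans ?_
  rw [Measure.map_addHaar_smul _ (Real.sqrt_pos.2 hc).ne']
  exact Measure.smul_absolutelyContinuous

open Matrix in
theorem charFun_gaussianConv {ℓ : ℕ} {c : ℝ} (hc : 0 ≤ c) {S : Matrix (Fin ℓ) (Fin ℓ) ℝ}
    (hS : S.PosSemidef) (t : EuclideanSpace ℝ (Fin ℓ)) :
    charFun (gaussianConv c S) t = Real.exp (-(c * ∑ a, t a ^ 2 + ∑ a, ∑ b, t a * t b * S a b) / 2)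
      := by
  have : IsProbabilityMeasure ((stdGaussian (EuclideanSpace ℝ (Fin ℓ))).map fun x => √c • x) :=
    Measure.isProbabilityMeasure_map (by fun_prop)
  rw [gaussianConv, charFun_conv, charFun_map_smul, charFun_multivariateGaussian hS,
    charFun_stdGaussian, ← Complex.exp_add]
  have h1 : (t : Fin ℓ → ℝ) ⬝ᵥ S *ᵥ t = ∑ a, ∑ b, t a * t b * S a b := by
    simp only [dotProduct, mulVec, Finset.mul_sum]
    exact Finset.sum_congr rfl fun a _ => Finset.sum_congr rfl fun b _ => by ring
  have h2 : ((‖√c • t‖ : ℝ) : ℂ) ^ 2 = ((c * ∑ a, t a ^ 2 : ℝ) : ℂ) := by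
    rw [← Complex.ofReal_pow, norm_smul, mul_pow, EuclideanSpace.real_norm_sq_eq,
      Real.norm_of_nonneg (Real.sqrt_nonneg _), Real.sq_sqrt hc]
  rw [h1, h2]
  push_cast
  congr 1
  simp
  ring

end AbsolutelyContinuous

/-! ### Characteristic functions of the scaled marginals. -/

section Marginal

variable {k n ℓ : ℕ}

/-- The linear map `x ↦ θ (x_{I a})_a`. -/
noncomputable def scaledMarginal (θ : ℝ) (I : Fin ℓ ↪ Fin n) :
    (Fin n → ℝ) →L[ℝ] EuclideanSpace ℝ (Fin ℓ) :=
  θ • ((PiLp.continuousLinearEquiv 2 ℝ fun _ : Fin ℓ => ℝ).symm.toContinuousLinearMap.comp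
    (ContinuousLinearMap.pi fun a => ContinuousLinearMap.proj (I a)))

theorem scaledMarginal_apply (θ : ℝ) (I : Fin ℓ ↪ Fin n) (x : Fin n → ℝ) (a : Fin ℓ) :
    scaledMarginal θ I x a = θ * x (I a) := rfl

theorem charFun_map_scaledMarginal (P : Measure (Fin n → ℝ)) (θ : ℝ) (I : Fin ℓ ↪ Fin n)
    (t : EuclideanSpace ℝ (Fin ℓ)) :
    charFun (P.map (scaledMarginal θ I)) t
      = ∫ x, Complex.exp ((∑ a, t a * (θ * x (I a)) : ℝ) * Complex.I) ∂P := by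
  rw [charFun_apply, integral_map (scaledMarginal θ I).measurable.aemeasurable
    (by fun_prop)]
  simp only [PiLp.inner_apply, scaledMarginal_apply]
  simp

theorem charFun_map_scaledMarginal_conv (P Q : Measure (Fin n → ℝ)) [IsProbabilityMeasure P]
    [IsProbabilityMeasure Q] (θ : ℝ) (I : Fin ℓ ↪ Fin n) (t : EuclideanSpace ℝ (Fin ℓ)) :
    charFun ((P.conv Q).map (scaledMarginal θ I)) t
      = charFun (P.map (scaledMarginal θ I)) t * charFun (Q.map (scaledMarginal θ I)) t := by
  have := Measure.isProbabilityMeasure_map (μ := P) (scaledMarginal θ I).measurable.aemeasurable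
  have := Measure.isProbabilityMeasure_map (μ := Q) (scaledMarginal θ I).measurable.aemeasurable
  rw [Measure.map_conv_continuousLinearMap, charFun_conv]

theorem charFun_map_scaledMarginal_bilinLaw (ρ ζ : Measure ℝ) [IsProbabilityMeasure ρ]
    [IsProbabilityMeasure ζ] (θ : ℝ) (I : Fin ℓ ↪ Fin n) (t : EuclideanSpace ℝ (Fin ℓ)) :
    charFun ((bilinLaw k n ρ ζ).map (scaledMarginal θ I)) t
      = ∫ s, ∫ c, Complex.exp ((∑ p, c p * (θ * rowForm t (fun a => wrapSign (I a))
          (fun a => reflect k (I a)) s p) : ℝ) * Complex.I)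
          ∂(Measure.pi fun _ : Fin k × Fin n => ζ) ∂(Measure.pi fun _ : Fin k × Fin n => ρ) := by
  have hm : Measurable fun x : Fin n → ℝ =>
      Complex.exp ((∑ a, t a * (θ * x (I a)) : ℝ) * Complex.I) := by fun_prop
  rw [charFun_map_scaledMarginal, bilinLaw, integral_map measurable_bilin.aemeasurable
    hm.aestronglyMeasurable, integral_prod]
  · refine integral_congr_ae (.of_forall fun s => integral_congr_ae (.of_forall fun c => ?_))
    simp only [bilin, rowForm, Finset.mul_sum]
    rw [Finset.sum_comm]
    congr 3
    exact Finset.sum_congr rfl fun p _ => Finset.sum_congr rfl fun a _ => by ring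
  · refine Integrable.of_bound (hm.comp measurable_bilin).aestronglyMeasurable 1
      (.of_forall fun x => ?_)
    rw [Complex.norm_exp_ofReal_mul_I]

/-- Times the variance of the entries of `s`, this is the variance of the sum of the coefficients;
here the overlaps enter the limit. -/
theorem sum_colForm_sq (t : Fin ℓ → ℝ) (I : Fin ℓ ↪ Fin n) :
    ∑ q : Fin k × Fin n, colForm t (fun a => wrapSign (I a)) (fun a => reflect k (I a)) q ^ 2
      = k * ∑ a, ∑ b, t a * t b * overlap n (I a) (I b) := by
  have h : ∀ q : Fin k × Fin n,
      colForm t (fun a => wrapSign (I a)) (fun a => reflect k (I a)) q ^ 2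
        = ∑ a, ∑ b, t a * t b * (wrapSign (I a) q * wrapSign (I b) q) := by
    intro q
    simp only [colForm, reflect_symm, wrapSign_reflect]
    rw [sq, Finset.sum_mul_sum]
    exact Finset.sum_congr rfl fun a _ => Finset.sum_congr rfl fun b _ => by ring
  simp only [h]
  rw [Finset.sum_comm, Finset.mul_sum]
  refine Finset.sum_congr rfl fun a _ => ?_
  rw [Finset.sum_comm, Finset.mul_sum]
  refine Finset.sum_congr rfl fun b _ => ?_
  rw [← Finset.mul_sum, sum_wrapSign_mul_wrapSign]
  ring

/-- The coordinates of the bilinear form have, after scaling by `n^(-1/2)`, nearly Gaussian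
characteristic functions, uniformly in the choice of coordinates. -/
theorem exists_forall_norm_charFun_bilinLaw_sub_le (k : ℕ) {ρ ζ : Measure ℝ}
    [IsProbabilityMeasure ρ] [IsProbabilityMeasure ζ] {B : ℝ} (hB : ∀ᵐ x ∂ρ, |x| ≤ B)
    (h0 : ∫ x, x ∂ρ = 0) (hζ : MemLp id 2 ζ) (t : EuclideanSpace ℝ (Fin ℓ)) {ε : ℝ} (hε : 0 < ε) :
    ∃ N : ℕ, ∀ n ≥ N, ∀ I : Fin ℓ ↪ Fin n,
      ‖charFun ((bilinLaw k n ρ ζ).map (scaledMarginal (√n)⁻¹ I)) t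
        - Real.exp (-(k * Var[id; ρ] * Var[id; ζ] * ∑ a, t a ^ 2
          + ∑ a, ∑ b, t a * t b * (k * Var[id; ρ] * (∫ x, x ∂ζ) ^ 2
            * (overlap n (I a) (I b) / n))) / 2)‖ ≤ ε := by
  -- Here `|J| = kn` and `θ = n^(-1/2)`, so `|J|θ² = k` and the bound `K` is `k`.
  obtain ⟨δ, hδ, h⟩ := exists_norm_integral_rowForm_sub_le t hB h0 hζ (Nat.cast_nonneg k) hε
  obtain ⟨N, hN⟩ := exists_nat_gt (1 / δ ^ 2)
  refine ⟨max N 1, fun n hn I => ?_⟩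
  have hn1 : (0 : ℝ) < n := by
    have : 0 < n := lt_of_lt_of_le one_pos ((le_max_right N 1).trans hn)
    exact_mod_cast this
  have hnN : 1 / δ ^ 2 < n := hN.trans_le (by exact_mod_cast (le_max_left N 1).trans hn)
  have hsq : ((√(n : ℝ))⁻¹) ^ 2 = (n : ℝ)⁻¹ := by rw [inv_pow, Real.sq_sqrt hn1.le]
  have hθδ : (√(n : ℝ))⁻¹ ≤ δ := by
    rw [inv_le_comm₀ (Real.sqrt_pos.2 hn1) hδ]
    refine Real.le_sqrt_of_sq_le ?_
    rw [inv_pow, ← one_div]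
    exact hnN.le
  have h1 := h (Fin k × Fin n) (√(n : ℝ))⁻¹ (fun a => wrapSign (I a)) (fun a => reflect k (I a))
    (by positivity) hθδ (by
      rw [hsq, Fintype.card_prod, Fintype.card_fin, Fintype.card_fin]
      push_cast
      field_simp
      exact le_refl _) (fun a p => wrapSign_sq (I a) p)
    fun p => (reflect_injective p).comp I.injective
  rw [charFun_map_scaledMarginal_bilinLaw]
  convert h1 using 6
  rw [hsq, sum_colForm_sq, Fintype.card_prod, Fintype.card_fin, Fintype.card_fin]
  have e : ∑ a, ∑ b, t a * t b * (k * Var[id; ρ] * (∫ x, x ∂ζ) ^ 2 * (overlap n (I a) (I b) / n))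
      = Var[id; ρ] * ((∫ x, x ∂ζ) ^ 2
        * ((n : ℝ)⁻¹ * (k * ∑ a, ∑ b, t a * t b * overlap n (I a) (I b)))) := by
    simp only [Finset.mul_sum]
    exact Finset.sum_congr rfl fun a _ => Finset.sum_congr rfl fun b _ => by ring
  rw [e]
  push_cast
  field_simp

/-- With `θ = n^(-1/2)` this makes `e₂` disappear in the limit. -/
theorem norm_charFun_pi_sub_one_le {μ : Measure ℝ} [IsProbabilityMeasure μ] {B : ℝ}
    (hB : ∀ᵐ x ∂μ, |x| ≤ B) {θ : ℝ} (hθ : 0 ≤ θ) (I : Fin ℓ ↪ Fin n)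
    (t : EuclideanSpace ℝ (Fin ℓ)) :
    ‖charFun ((Measure.pi fun _ : Fin n => μ).map (scaledMarginal θ I)) t - 1‖
      ≤ θ * (B * ∑ a, |t a|) := by
  have hm : Measurable fun x : Fin n → ℝ =>
      Complex.exp ((∑ a, t a * (θ * x (I a)) : ℝ) * Complex.I) := by fun_prop
  have hi : Integrable (fun x : Fin n → ℝ =>
      Complex.exp ((∑ a, t a * (θ * x (I a)) : ℝ) * Complex.I)) (Measure.pi fun _ => μ) :=
    Integrable.of_bound hm.aestronglyMeasurable 1 (.of_forall fun x => by
      rw [Complex.norm_exp_ofReal_mul_I])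
  rw [charFun_map_scaledMarginal]
  have h1 : (1 : ℂ) = ∫ _ : Fin n → ℝ, (1 : ℂ) ∂(Measure.pi fun _ => μ) := by simp
  rw [h1, ← integral_sub hi (integrable_const _)]
  refine (norm_integral_le_of_norm_le_const (C := θ * (B * ∑ a, |t a|)) ?_).trans (by simp)
  filter_upwards [ae_pi_of_ae (J := Fin n) hB] with x hx
  rw [mul_comm (Complex.ofReal _)]
  refine Real.norm_exp_I_mul_ofReal_sub_one_le.trans ?_
  rw [Real.norm_eq_abs, Finset.mul_sum, Finset.mul_sum]
  refine (Finset.abs_sum_le_sum_abs _ _).trans (Finset.sum_le_sum fun a _ => ?_)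
  rw [abs_mul, abs_mul, abs_of_nonneg hθ]
  calc |t a| * (θ * |x (I a)|) ≤ |t a| * (θ * B) := by
        gcongr
        exact hx _
    _ = _ := by ring

theorem sum_ite_embedding (I : Fin ℓ ↪ Fin n) (t : Fin ℓ → ℝ) (f : Fin n → ℝ) :
    ∑ i, (∑ a, if I a = i then t a else 0) * f i = ∑ a, t a * f (I a) := by
  simp only [Finset.sum_mul]
  rw [Finset.sum_comm]
  refine Finset.sum_congr rfl fun a _ => ?_
  simp [ite_mul]

open Matrix in
theorem charFun_map_scaledMarginal_gaussian {S : Matrix (Fin n) (Fin n) ℝ} (hS : S.PosSemidef)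
    (θ : ℝ) (I : Fin ℓ ↪ Fin n) (t : EuclideanSpace ℝ (Fin ℓ)) :
    charFun (((multivariateGaussian 0 S).map fun x => (fun i => x i)).map (scaledMarginal θ I)) t
      = Real.exp (-(∑ a, ∑ b, t a * t b * (θ ^ 2 * S (I a) (I b))) / 2) := by
  have hm : Measurable fun (x : EuclideanSpace ℝ (Fin n)) => (fun i => x i) := by fun_prop
  have hm' : Measurable fun x : Fin n → ℝ =>
      Complex.exp ((∑ a, t a * (θ * x (I a)) : ℝ) * Complex.I) := by fun_prop
  rw [charFun_map_scaledMarginal, integral_map hm.aemeasurable hm'.aestronglyMeasurable]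
  -- `y` is the transpose of the scaled marginal map applied to `t`.
  let y : EuclideanSpace ℝ (Fin n) := WithLp.toLp 2 fun i => ∑ a, if I a = i then θ * t a else 0
  have hy : ∀ i, y i = ∑ a, if I a = i then θ * t a else 0 := fun i => rfl
  have h := charFun_multivariateGaussian (μ := 0) hS y
  rw [charFun_apply] at h
  refine Eq.trans (integral_congr_ae (.of_forall fun x => ?_)) (h.trans ?_)
  · simp only [PiLp.inner_apply, hy]
    congr 3
    have e := sum_ite_embedding I (fun a => θ * t a) fun i => x i
    simp only [RCLike.inner_apply, conj_trivial]
    rw [e]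
    exact Finset.sum_congr rfl fun a _ => by ring
  · have e : (y : Fin n → ℝ) ⬝ᵥ S *ᵥ y = ∑ a, ∑ b, t a * t b * (θ ^ 2 * S (I a) (I b)) := by
      simp only [dotProduct, mulVec, hy]
      rw [sum_ite_embedding I fun a => θ * t a]
      refine Finset.sum_congr rfl fun a _ => ?_
      have e2 := sum_ite_embedding I (fun a => θ * t a) fun i => S (I a) i
      simp only [mul_comm (S (I a) _)]
      rw [e2, Finset.mul_sum]
      exact Finset.sum_congr rfl fun b _ => by ring
    rw [e]
    push_cast
    congr 1
    simp
    ring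

end Marginal

/-! ### Common limits along subsequences and the convex central limit theorem. -/

section Limit

variable {ℓ : ℕ}

open Matrix in
theorem posSemidef_of_tendsto {M : ℕ → Matrix (Fin ℓ) (Fin ℓ) ℝ} {L : Matrix (Fin ℓ) (Fin ℓ) ℝ}
    (hM : ∀ j, (M j).PosSemidef)
    (h : ∀ a b, Filter.Tendsto (fun j => M j a b) Filter.atTop (nhds (L a b))) : L.PosSemidef := by
  rw [posSemidef_iff_dotProduct_mulVec]
  constructor
  · ext a b
    refine tendsto_nhds_unique (h b a) ((h a b).congr fun j => ?_)
    have := congrFun (congrFun (hM j).isHermitian a) b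
    simpa using this.symm
  · intro x
    have ht : Filter.Tendsto (fun j => star x ⬝ᵥ M j *ᵥ x) Filter.atTop
        (nhds (star x ⬝ᵥ L *ᵥ x)) := by
      simp only [dotProduct, mulVec]
      exact tendsto_finsetSum _ fun a _ => (tendsto_finsetSum _ fun b _ =>
        (h a b).mul_const _).const_mul _
    exact ge_of_tendsto' ht fun j => (hM j).dotProduct_mulVec_nonneg x

/-- The overlaps of the coordinates `I`, divided by `n`. -/
noncomputable def overlapRatio {n : ℕ} (I : Fin ℓ ↪ Fin n) : Matrix (Fin ℓ) (Fin ℓ) ℝ :=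
  Matrix.of fun a b => overlap n (I a) (I b) / n

theorem posSemidef_overlapRatio {n : ℕ} (I : Fin ℓ ↪ Fin n) : (overlapRatio I).PosSemidef := by
  have h := ((posSemidef_overlap n).submatrix I).smul (α := ℝ) (a := (n : ℝ)⁻¹) (by positivity)
  convert h using 1
  ext a b
  simp [overlapRatio, div_eq_inv_mul]

theorem abs_overlapRatio_le {n : ℕ} (I : Fin ℓ ↪ Fin n) (a b : Fin ℓ) :
    |overlapRatio I a b| ≤ 1 := by
  have h1 : ((I a : ℕ) : ℝ) ≤ n := by exact_mod_cast (I a).isLt.le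
  have h2 : ((I b : ℕ) : ℝ) ≤ n := by exact_mod_cast (I b).isLt.le
  have h3 : (0 : ℝ) ≤ ((I a : ℕ) : ℝ) := Nat.cast_nonneg _
  have h4 : (0 : ℝ) ≤ ((I b : ℕ) : ℝ) := Nat.cast_nonneg _
  have h5 : |((I a : ℕ) : ℝ) - ((I b : ℕ) : ℝ)| ≤ n := by
    rw [abs_le]
    constructor <;> linarith
  have h6 := abs_nonneg (((I a : ℕ) : ℝ) - ((I b : ℕ) : ℝ))
  rw [overlapRatio, Matrix.of_apply, abs_div, abs_of_nonneg (Nat.cast_nonneg n : (0 : ℝ) ≤ n)]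
  refine div_le_one_of_le₀ ?_ (Nat.cast_nonneg n)
  rw [overlap, Matrix.of_apply, abs_le]
  constructor <;> linarith

theorem tendsto_of_forall_norm_sub_le {f g : ℕ → ℂ} {L : ℂ} (hg : Filter.Tendsto g Filter.atTop
    (nhds L)) (h : ∀ ε > 0, ∀ᶠ j in Filter.atTop, ‖f j - g j‖ ≤ ε) :
    Filter.Tendsto f Filter.atTop (nhds L) := by
  have h0 : Filter.Tendsto (fun j => f j - g j) Filter.atTop (nhds 0) := by
    rw [Metric.tendsto_nhds]
    intro ε hε
    filter_upwards [h (ε / 2) (half_pos hε)] with j hj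
    rw [dist_zero_right]
    linarith
  simpa using h0.add hg

variable (k η₁ η₂ : ℕ) (ψ : Measure ℤ)

/-- The covariance matrix of the noise without `c_v`. -/
noncomputable def noiseCov (n : ℕ) : Matrix (Fin n) (Fin n) ℝ :=
  sigmaSq k η₁ η₂ ψ n • 1 + ((k * η₁ : ℝ) / 2 * (∫ c, (c : ℝ) ∂ψ) ^ 2) • overlap n

theorem posSemidef_noiseCov (n : ℕ) : (noiseCov k η₁ η₂ ψ n).PosSemidef := by
  have h : 0 ≤ sigmaSq k η₁ η₂ ψ n := by
    have := variance_nonneg (fun c : ℤ => (c : ℝ)) ψ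
    unfold sigmaSq
    positivity
  exact (Matrix.PosSemidef.one.smul h).add ((posSemidef_overlap n).smul (by positivity))

/-- The limit of `σ_G² / n`. -/
noncomputable def sigmaSqRate : ℝ :=
  (k * η₁ ^ 2 : ℝ) / 4 + (k * η₁ : ℝ) / 2 * ((η₂ : ℝ) / 2 + Var[fun c : ℤ => (c : ℝ); ψ])

theorem sigmaSqRate_pos {k η₁ : ℕ} (hk : 0 < k) (hη₁ : 0 < η₁) : 0 < sigmaSqRate k η₁ η₂ ψ := by
  have := variance_nonneg (fun c : ℤ => (c : ℝ)) ψ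
  unfold sigmaSqRate
  positivity

/-- The law on `ℝⁿ` of the Gaussian comparison vector. -/
noncomputable def gaussianLaw {n : ℕ} (S : Matrix (Fin n) (Fin n) ℝ) : Measure (Fin n → ℝ) :=
  (multivariateGaussian 0 S).map fun x => (fun i => x i)

instance {n : ℕ} (S : Matrix (Fin n) (Fin n) ℝ) : IsProbabilityMeasure (gaussianLaw S) :=
  Measure.isProbabilityMeasure_map (by fun_prop)

instance [IsProbabilityMeasure ψ] (n : ℕ) :
    IsProbabilityMeasure (smoothNoiseLaw k η₁ η₂ ψ n) := by
  unfold smoothNoiseLaw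
  infer_instance

/-- The limit of the characteristic functions of the scaled marginals. -/
noncomputable def limitLaw (Θ : Matrix (Fin ℓ) (Fin ℓ) ℝ) : Measure (EuclideanSpace ℝ (Fin ℓ)) :=
  gaussianConv (sigmaSqRate k η₁ η₂ ψ) (((k * η₁ : ℝ) / 2 * (∫ c, (c : ℝ) ∂ψ) ^ 2) • Θ)

instance (Θ : Matrix (Fin ℓ) (Fin ℓ) ℝ) : IsProbabilityMeasure (limitLaw k η₁ η₂ ψ Θ) := by
  unfold limitLaw
  infer_instance

variable {k η₁}

theorem charFun_limitLaw (hk : 0 < k) (hη₁ : 0 < η₁) {Θ : Matrix (Fin ℓ) (Fin ℓ) ℝ}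
    (hΘ : Θ.PosSemidef) (t : EuclideanSpace ℝ (Fin ℓ)) :
    charFun (limitLaw k η₁ η₂ ψ Θ) t = Real.exp (-(sigmaSqRate k η₁ η₂ ψ * ∑ a, t a ^ 2
      + ∑ a, ∑ b, t a * t b * ((k * η₁ : ℝ) / 2 * (∫ c, (c : ℝ) ∂ψ) ^ 2 * Θ a b)) / 2) := by
  rw [limitLaw, charFun_gaussianConv (sigmaSqRate_pos η₂ ψ hk hη₁).le (hΘ.smul (by positivity))]
  rfl

theorem isCentredCov_smoothNoiseLaw {ψ : Measure ℤ} [IsProbabilityMeasure ψ]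
    (hψ : MemLp (fun c : ℤ => (c : ℝ)) 2 ψ) (k η₁ n : ℕ) :
    IsCentredCov (smoothNoiseLaw k η₁ η₂ ψ n) (noiseCov k η₁ η₂ ψ n) := by
  have hA := isCentredCov_bilinLaw (k := k) (n := n) (memLp_centralBinomial η₁)
    (integral_id_centralBinomial η₁) (memLp_centralBinomial η₁)
  have hB := isCentredCov_bilinLaw (k := k) (n := n) (memLp_centralBinomial η₁)
    (integral_id_centralBinomial η₁)
    (memLp_negAddLaw (memLp_centralBinomial η₂) (memLp_castLaw hψ))
  have hE := isCentredCov_pi (n := n) (memLp_centralBinomial η₂) (integral_id_centralBinomial η₂)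
  have h := hA.conv (hB.conv hE)
  rw [smoothNoiseLaw]
  convert h using 1
  rw [integral_id_negAddLaw (memLp_centralBinomial η₂) (memLp_castLaw hψ),
    variance_negAddLaw (memLp_centralBinomial η₂) (memLp_castLaw hψ)]
  simp only [variance_centralBinomial, integral_id_centralBinomial, variance_castLaw ψ,
    integral_castLaw ψ measurable_id']
  rw [noiseCov, sigmaSq]
  ext i j
  simp only [Matrix.add_apply, Matrix.smul_apply, smul_eq_mul]
  ring

/-- Three factors: `eᵀr` has both families centred and gives no overlap term, the second form gives
it through the mean of `c_u`, and the factor of `e₂` tends to `1`. -/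
theorem tendsto_charFun_smoothNoiseLaw {ψ : Measure ℤ} [IsProbabilityMeasure ψ]
    (hψ : MemLp (fun c : ℤ => (c : ℝ)) 2 ψ) (hk : 0 < k) (hη₁ : 0 < η₁) {N : ℕ → ℕ}
    (hN : Filter.Tendsto N Filter.atTop Filter.atTop) (I : ∀ j, Fin ℓ ↪ Fin (N j))
    {Θ : Matrix (Fin ℓ) (Fin ℓ) ℝ} (hI : ∀ a b, Filter.Tendsto
      (fun j => overlapRatio (I j) a b) Filter.atTop (nhds (Θ a b)))
    (t : EuclideanSpace ℝ (Fin ℓ)) :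
    Filter.Tendsto (fun j => charFun ((smoothNoiseLaw k η₁ η₂ ψ (N j)).map
      (scaledMarginal (√(N j))⁻¹ (I j))) t) Filter.atTop
      (nhds (charFun (limitLaw k η₁ η₂ ψ Θ) t)) := by
  have hΘ := posSemidef_of_tendsto (fun j => posSemidef_overlapRatio (I j)) hI
  have hexp : ∀ c d : ℝ, Filter.Tendsto (fun j => ((Real.exp (-(c * ∑ a, t a ^ 2
      + ∑ a, ∑ b, t a * t b * (d * overlapRatio (I j) a b)) / 2) : ℝ) : ℂ)) Filter.atTop
      (nhds (Real.exp (-(c * ∑ a, t a ^ 2 + ∑ a, ∑ b, t a * t b * (d * Θ a b)) / 2) : ℝ)) := by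
    intro c d
    refine (Complex.continuous_ofReal.tendsto _).comp ((Real.continuous_exp.tendsto _).comp ?_)
    refine ((tendsto_const_nhds.add ?_).neg).div_const 2
    exact tendsto_finsetSum _ fun a _ => tendsto_finsetSum _ fun b _ =>
      ((hI a b).const_mul d).const_mul _
  have hblock : ∀ ζ : Measure ℝ, ∀ [IsProbabilityMeasure ζ], MemLp id 2 ζ →
      Filter.Tendsto (fun j => charFun ((bilinLaw k (N j) (castLaw (centralBinomial η₁)) ζ).map
        (scaledMarginal (√(N j))⁻¹ (I j))) t) Filter.atTop
        (nhds (Real.exp (-(k * Var[id; castLaw (centralBinomial η₁)] * Var[id; ζ] * ∑ a, t a ^ 2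
          + ∑ a, ∑ b, t a * t b * (k * Var[id; castLaw (centralBinomial η₁)] * (∫ x, x ∂ζ) ^ 2
            * Θ a b)) / 2) : ℝ)) := by
    intro ζ _ hζ
    refine tendsto_of_forall_norm_sub_le (hexp _ _) fun ε hε => ?_
    obtain ⟨M, hM⟩ := exists_forall_norm_charFun_bilinLaw_sub_le k
      (abs_le_ae_centralBinomial η₁) (integral_id_centralBinomial η₁) hζ t hε
    filter_upwards [hN.eventually_ge_atTop M] with j hj using hM (N j) hj (I j)
  have hE : Filter.Tendsto (fun j => charFun ((Measure.pi fun _ : Fin (N j) =>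
      castLaw (centralBinomial η₂)).map (scaledMarginal (√(N j))⁻¹ (I j))) t) Filter.atTop
      (nhds 1) := by
    refine tendsto_of_forall_norm_sub_le tendsto_const_nhds fun ε hε => ?_
    have h0 : Filter.Tendsto (fun j => (√(N j : ℝ))⁻¹ * (η₂ * ∑ a, |t a|)) Filter.atTop
        (nhds (0 * (η₂ * ∑ a, |t a|))) := by
      refine Filter.Tendsto.mul_const _ (tendsto_inv_atTop_zero.comp ?_)
      exact Real.tendsto_sqrt_atTop.comp (tendsto_natCast_atTop_atTop.comp hN)
    rw [zero_mul] at h0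
    filter_upwards [h0.eventually_le_const hε] with j hj
    exact (norm_charFun_pi_sub_one_le (abs_le_ae_centralBinomial η₂) (by positivity) _ t).trans hj
  have hA := hblock _ (memLp_centralBinomial η₁)
  have hB := hblock _ (memLp_negAddLaw (memLp_centralBinomial η₂) (memLp_castLaw hψ))
  have h := hA.mul (hB.mul hE)
  have hlim : charFun (limitLaw k η₁ η₂ ψ Θ) t = _ := charFun_limitLaw η₂ ψ hk hη₁ hΘ t
  rw [hlim]
  simp only [smoothNoiseLaw, charFun_map_scaledMarginal_conv]
  convert h using 2
  rw [mul_one, ← Complex.ofReal_mul, ← Real.exp_add,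
    integral_id_negAddLaw (memLp_centralBinomial η₂) (memLp_castLaw hψ),
    variance_negAddLaw (memLp_centralBinomial η₂) (memLp_castLaw hψ)]
  simp only [variance_centralBinomial, integral_id_centralBinomial, variance_castLaw ψ,
    integral_castLaw ψ measurable_id']
  congr 2
  have h1 : ∑ a, ∑ b, t a * t b * ((k : ℝ) * ((η₁ : ℝ) / 2) * 0 ^ 2 * Θ a b) = 0 := by simp
  have h2 : ∑ a, ∑ b, t a * t b
      * ((k : ℝ) * ((η₁ : ℝ) / 2) * (-(0 + ∫ c, (c : ℝ) ∂ψ)) ^ 2 * Θ a b)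
      = ∑ a, ∑ b, t a * t b * ((k * η₁ : ℝ) / 2 * (∫ c, (c : ℝ) ∂ψ) ^ 2 * Θ a b) :=
    Finset.sum_congr rfl fun a _ => Finset.sum_congr rfl fun b _ => by ring
  rw [h1, h2, sigmaSqRate]
  ring

/-- The scaled covariance differs from that of the limit only by `η₂/(2n)` on the diagonal and by
the convergence of the overlap ratios. -/
theorem tendsto_charFun_gaussianLaw (hk : 0 < k) (hη₁ : 0 < η₁) {N : ℕ → ℕ}
    (hN : Filter.Tendsto N Filter.atTop Filter.atTop) (I : ∀ j, Fin ℓ ↪ Fin (N j))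
    {Θ : Matrix (Fin ℓ) (Fin ℓ) ℝ} (hI : ∀ a b, Filter.Tendsto
      (fun j => overlapRatio (I j) a b) Filter.atTop (nhds (Θ a b)))
    (t : EuclideanSpace ℝ (Fin ℓ)) :
    Filter.Tendsto (fun j => charFun ((gaussianLaw (noiseCov k η₁ η₂ ψ (N j))).map
      (scaledMarginal (√(N j))⁻¹ (I j))) t) Filter.atTop
      (nhds (charFun (limitLaw k η₁ η₂ ψ Θ) t)) := by
  have hΘ := posSemidef_of_tendsto (fun j => posSemidef_overlapRatio (I j)) hI
  rw [charFun_limitLaw η₂ ψ hk hη₁ hΘ]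
  have hform : ∀ᶠ j in Filter.atTop, charFun ((gaussianLaw (noiseCov k η₁ η₂ ψ (N j))).map
      (scaledMarginal (√(N j))⁻¹ (I j))) t
      = (Real.exp (-((sigmaSqRate k η₁ η₂ ψ + (η₂ : ℝ) / 2 * (N j : ℝ)⁻¹) * ∑ a, t a ^ 2
        + ∑ a, ∑ b, t a * t b * ((k * η₁ : ℝ) / 2 * (∫ c, (c : ℝ) ∂ψ) ^ 2
          * overlapRatio (I j) a b)) / 2) : ℝ) := by
    filter_upwards [hN.eventually_ge_atTop 1] with j hj
    have hpos : (0 : ℝ) < N j := by exact_mod_cast hj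
    have hsq : ((√(N j : ℝ))⁻¹) ^ 2 = (N j : ℝ)⁻¹ := by rw [inv_pow, Real.sq_sqrt hpos.le]
    have hσ : (N j : ℝ)⁻¹ * sigmaSq k η₁ η₂ ψ (N j)
        = sigmaSqRate k η₁ η₂ ψ + (η₂ : ℝ) / 2 * (N j : ℝ)⁻¹ := by
      rw [sigmaSq, sigmaSqRate]
      field_simp
    have hentry : ∀ a b, (N j : ℝ)⁻¹ * noiseCov k η₁ η₂ ψ (N j) (I j a) (I j b)
        = (if a = b then sigmaSqRate k η₁ η₂ ψ + (η₂ : ℝ) / 2 * (N j : ℝ)⁻¹ else 0)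
          + (k * η₁ : ℝ) / 2 * (∫ c, (c : ℝ) ∂ψ) ^ 2 * overlapRatio (I j) a b := by
      intro a b
      rw [← hσ, noiseCov, Matrix.add_apply, Matrix.smul_apply, Matrix.smul_apply, Matrix.one_apply,
        overlapRatio, Matrix.of_apply]
      simp only [EmbeddingLike.apply_eq_iff_eq, smul_eq_mul]
      split_ifs
      · field_simp
      · field_simp
        ring
    rw [gaussianLaw, charFun_map_scaledMarginal_gaussian (posSemidef_noiseCov k η₁ η₂ ψ (N j)), hsq]
    have hsum : ∀ (K : ℝ) (X : Fin ℓ → Fin ℓ → ℝ),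
        ∑ a, ∑ b, t a * t b * ((if a = b then K else 0) + X a b)
          = K * ∑ a, t a ^ 2 + ∑ a, ∑ b, t a * t b * X a b := by
      intro K X
      simp only [mul_add, Finset.sum_add_distrib, mul_ite, mul_zero, Finset.sum_ite_eq,
        Finset.mem_univ, if_true]
      rw [Finset.mul_sum]
      congr 1
      exact Finset.sum_congr rfl fun a _ => by ring
    simp only [hentry, hsum]
  refine Filter.Tendsto.congr' (hform.mono fun j hj => hj.symm) ?_
  refine (Complex.continuous_ofReal.tendsto _).comp ((Real.continuous_exp.tendsto _).comp ?_)
  refine ((Filter.Tendsto.add ?_ ?_).neg).div_const 2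
  · refine Filter.Tendsto.mul_const _ ?_
    have h0 : Filter.Tendsto (fun j => ((N j : ℝ))⁻¹) Filter.atTop (nhds 0) :=
      tendsto_inv_atTop_zero.comp (tendsto_natCast_atTop_atTop.comp hN)
    simpa using tendsto_const_nhds.add (h0.const_mul ((η₂ : ℝ) / 2))
  · exact tendsto_finsetSum _ fun a _ => tendsto_finsetSum _ fun b _ =>
      ((hI a b).const_mul _).const_mul _

/-- The convex central limit theorem for the noise without `c_v`. -/
theorem eventually_forall_abs_smoothNoiseLaw_sub_le {ψ : Measure ℤ} [IsProbabilityMeasure ψ]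
    (hψ : MemLp (fun c : ℤ => (c : ℝ)) 2 ψ) (hk : 0 < k) (hη₁ : 0 < η₁) (ℓ : ℕ) {ε : ℝ}
    (hε : 0 < ε) :
    ∀ᶠ n in Filter.atTop, ∀ (I : Fin ℓ ↪ Fin n) (A : Set (Fin ℓ → ℝ)), MeasurableSet A →
      Convex ℝ A → |(smoothNoiseLaw k η₁ η₂ ψ n).real {x | (fun a => x (I a)) ∈ A}
        - (gaussianLaw (noiseCov k η₁ η₂ ψ n)).real {x | (fun a => x (I a)) ∈ A}| ≤ ε := by
  -- Since no single limit law exists, bad coordinates and sets are collected along a sequence, from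
  -- which compactness extracts convergent overlap ratios.
  by_contra hcon
  obtain ⟨N, hNmono, hbad⟩ := Filter.extraction_of_frequently_atTop
    (Filter.not_eventually.1 hcon)
  push Not at hbad
  choose I A hAm hA hgap using hbad
  have hbdd : ∀ j, (fun a b => overlapRatio (I j) a b) ∈
      Metric.closedBall (0 : Fin ℓ → Fin ℓ → ℝ) 1 := by
    intro j
    rw [mem_closedBall_zero_iff, pi_norm_le_iff_of_nonneg zero_le_one]
    intro a
    rw [pi_norm_le_iff_of_nonneg zero_le_one]
    intro b
    exact abs_overlapRatio_le (I j) a b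
  obtain ⟨Θ, -, φ, hφ, hΘ⟩ := tendsto_subseq_of_bounded Metric.isBounded_closedBall hbdd
  have hI : ∀ a b, Filter.Tendsto (fun j => overlapRatio (I (φ j)) a b) Filter.atTop
      (nhds (Matrix.of Θ a b)) := fun a b =>
    (tendsto_pi_nhds.1 ((tendsto_pi_nhds.1 hΘ) a)) b
  have hNφ : Filter.Tendsto (fun j => N (φ j)) Filter.atTop Filter.atTop :=
    (hNmono.comp hφ).tendsto_atTop
  let L : ∀ j, (Fin (N (φ j)) → ℝ) →L[ℝ] EuclideanSpace ℝ (Fin ℓ) :=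
    fun j => scaledMarginal (√(N (φ j)))⁻¹ (I (φ j))
  let P : ℕ → ProbabilityMeasure (EuclideanSpace ℝ (Fin ℓ)) := fun j =>
    ⟨(smoothNoiseLaw k η₁ η₂ ψ (N (φ j))).map (L j),
      Measure.isProbabilityMeasure_map (L j).measurable.aemeasurable⟩
  let G : ℕ → ProbabilityMeasure (EuclideanSpace ℝ (Fin ℓ)) := fun j =>
    ⟨(gaussianLaw (noiseCov k η₁ η₂ ψ (N (φ j)))).map (L j),
      Measure.isProbabilityMeasure_map (L j).measurable.aemeasurable⟩
  let γ : ProbabilityMeasure (EuclideanSpace ℝ (Fin ℓ)) :=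
    ⟨limitLaw k η₁ η₂ ψ (Matrix.of Θ), inferInstance⟩
  have hγ : (γ : Measure (EuclideanSpace ℝ (Fin ℓ))) ≪ volume :=
    gaussianConv_absolutelyContinuous (sigmaSqRate_pos η₂ ψ hk hη₁) _
  have hP : Filter.Tendsto P Filter.atTop (nhds γ) :=
    ProbabilityMeasure.tendsto_of_tendsto_charFun fun t =>
      tendsto_charFun_smoothNoiseLaw η₂ hψ hk hη₁ hNφ (fun j => I (φ j)) hI t
  have hG : Filter.Tendsto G Filter.atTop (nhds γ) :=
    ProbabilityMeasure.tendsto_of_tendsto_charFun fun t =>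
      tendsto_charFun_gaussianLaw η₂ ψ hk hη₁ hNφ (fun j => I (φ j)) hI t
  obtain ⟨j, h1, h2, h3⟩ := ((eventually_forall_convex_abs_sub_le hP hγ (half_pos hε)).and
    ((eventually_forall_convex_abs_sub_le hG hγ (half_pos hε)).and
      (hNφ.eventually_ge_atTop 1))).exists
  have hpos : (0 : ℝ) < √(N (φ j)) := Real.sqrt_pos.2 (by exact_mod_cast h3)
  -- `S` undoes the scaling. Being linear, it pulls convex sets back to convex sets.
  let S : EuclideanSpace ℝ (Fin ℓ) →ₗ[ℝ] (Fin ℓ → ℝ) :=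
    √(N (φ j)) • (PiLp.continuousLinearEquiv 2 ℝ fun _ : Fin ℓ => ℝ).toLinearMap
  have hSm : Measurable S := S.continuous_of_finiteDimensional.measurable
  have hSL : ∀ x : Fin (N (φ j)) → ℝ, S (L j x) = fun a => x (I (φ j) a) := by
    intro x
    ext a
    change √(N (φ j)) * ((√(N (φ j)))⁻¹ * x (I (φ j) a)) = _
    rw [mul_inv_cancel_left₀ hpos.ne']
  have hset : ∀ R : Measure (Fin (N (φ j)) → ℝ),
      (R.map (L j)).real (S ⁻¹' A (φ j)) = R.real {x | (fun a => x (I (φ j) a)) ∈ A (φ j)} := by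
    intro R
    rw [map_measureReal_apply (L j).measurable (hSm (hAm _))]
    congr 1
    ext x
    simp only [Set.mem_preimage, Set.mem_ofPred_eq, hSL]
  have e1 := h1 (S ⁻¹' A (φ j)) ((hA _).linear_preimage S) (hSm (hAm _))
  have e2 := h2 (S ⁻¹' A (φ j)) ((hA _).linear_preimage S) (hSm (hAm _))
  have e3 := hgap (φ j)
  simp only [P, G, ProbabilityMeasure.coe_mk, hset] at e1 e2
  rw [abs_sub_comm] at e2
  exact absurd ((abs_sub_le _ _ _).trans (add_le_add e1 e2)) (by rw [add_halves]; exact not_le.2 e3)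

end Limit

/-! ### Adding the uniform noise `c_v`. -/

section Assembly

variable {n : ℕ}

theorem measureReal_conv (P U : Measure (Fin n → ℝ)) [IsProbabilityMeasure P]
    [IsProbabilityMeasure U] {S : Set (Fin n → ℝ)} (hS : MeasurableSet S) :
    Integrable (fun y => P.real {x | x + y ∈ S}) U ∧
      (P.conv U).real S = ∫ y, P.real {x | x + y ∈ S} ∂U := by
  have hadd : Measurable fun p : (Fin n → ℝ) × (Fin n → ℝ) => p.1 + p.2 := by fun_prop
  have hm : Measurable fun y => P {x | x + y ∈ S} :=
    measurable_measure_prodMk_right (μ := P) (hadd hS)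
  constructor
  · refine Integrable.of_bound (C := 1) hm.ennreal_toReal.aestronglyMeasurable
      (Filter.Eventually.of_forall fun y => ?_)
    rw [Real.norm_of_nonneg measureReal_nonneg]
    exact measureReal_le_one
  · rw [Measure.conv, map_measureReal_apply hadd hS, measureReal_def,
      Measure.prod_apply_symm (hadd hS)]
    exact (integral_toReal hm.aemeasurable
      (Filter.Eventually.of_forall fun y => measure_lt_top _ _)).symm

/-- Given the independent summand `y`, the set `A` is merely translated and remains convex.
Averaging over `y` keeps the same `ε` for every `U`. -/
theorem marginalsClose_conv {P Q U : Measure (Fin n → ℝ)} [IsProbabilityMeasure P]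
    [IsProbabilityMeasure Q] [IsProbabilityMeasure U] {ℓ : ℕ} {ε : ℝ}
    (h : MarginalsClose ℓ ε P Q) : MarginalsClose ℓ ε (P.conv U) (Q.conv U) := by
  intro I A hAm hA
  have hS : MeasurableSet {x : Fin n → ℝ | (fun a => x (I a)) ∈ A} := by
    have hI : Measurable fun x : Fin n → ℝ => fun a => x (I a) := by fun_prop
    exact hI hAm
  obtain ⟨hP, eP⟩ := measureReal_conv P U hS
  obtain ⟨hQ, eQ⟩ := measureReal_conv Q U hS
  rw [eP, eQ, ← integral_sub hP hQ, ← Real.norm_eq_abs]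
  refine (norm_integral_le_of_norm_le_const (C := ε)
    (Filter.Eventually.of_forall fun y => ?_)).trans (by simp)
  rw [Real.norm_eq_abs]
  exact h I ((fun z => z + fun a => y (I a)) ⁻¹' A)
    ((measurable_add_const _) hAm) (hA.translate_preimage_left _)

theorem memLp_uniformOn {s : Set ℤ} (hs : s.Finite) (f : ℤ → ℝ) :
    MemLp f 2 (uniformOn s) := by
  obtain ⟨C, hC⟩ := (hs.image fun c => ‖f c‖).bddAbove
  have : IsFiniteMeasure (uniformOn s) := by unfold uniformOn; infer_instance
  refine MemLp.of_bound Measurable.of_discrete.aestronglyMeasurable C ?_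
  filter_upwards [ae_cond_mem hs.measurableSet] with c hc using hC ⟨c, hc, rfl⟩

theorem isProbabilityMeasure_discreteUniform {b : ℤ} (hb : 0 ≤ b) :
    IsProbabilityMeasure (discreteUniform b) :=
  isProbabilityMeasure_uniformOn (Set.finite_Icc _ _) ⟨0, by simp [hb]⟩

theorem halfWidth_nonneg (q d : ℕ) : 0 ≤ halfWidth q d := by
  rw [halfWidth, round_eq]
  positivity

theorem isProbabilityMeasure_roundingNoise {q : ℕ} (hq : 0 < q) (d : ℕ) :
    IsProbabilityMeasure (roundingNoise q d) := by
  have : IsProbabilityMeasure (uniformOn (Set.Ico (0 : ℤ) q)) :=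
    isProbabilityMeasure_uniformOn (Set.finite_Ico _ _) ⟨0, by simp [hq]⟩
  exact Measure.isProbabilityMeasure_map Measurable.of_discrete.aemeasurable

theorem memLp_roundingNoise (q d : ℕ) : MemLp (fun c : ℤ => (c : ℝ)) 2 (roundingNoise q d) :=
  (memLp_map_measure_iff measurable_intCast_real.aestronglyMeasurable
    Measurable.of_discrete.aemeasurable).2 (memLp_uniformOn (Set.finite_Ico _ _) _)

variable {ψ : Measure ℤ} [IsProbabilityMeasure ψ]

theorem sameMeanCov_noiseLaw (hψ : MemLp (fun c : ℤ => (c : ℝ)) 2 ψ) (k η₁ η₂ : ℕ) {b : ℤ}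
    (hb : 0 ≤ b) (n : ℕ) : SameMeanCov (noiseLaw k η₁ η₂ ψ b n)
      (gaussianPlusUniform (noiseCov k η₁ η₂ ψ n) b) := by
  have := isProbabilityMeasure_discreteUniform hb
  have hU := memLp_castLaw (memLp_uniformOn (Set.finite_Icc (-b) b) fun c => (c : ℝ))
  rw [noiseLaw_eq_conv]
  exact (isCentredCov_smoothNoiseLaw η₂ hψ k η₁ n).sameMeanCov_conv
    (Q := gaussianLaw (noiseCov k η₁ η₂ ψ n))
    (isCentredCov_multivariateGaussian (posSemidef_noiseCov k η₁ η₂ ψ n))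
    (U := Measure.pi fun _ => castLaw (discreteUniform b)) (memLp_eval_pi hU)

/-- `N` is fixed by the noise without `c_v`, before `b` appears. -/
theorem exists_forall_marginalsClose_noiseLaw (hψ : MemLp (fun c : ℤ => (c : ℝ)) 2 ψ) {k η₁ : ℕ}
    (η₂ : ℕ) (hk : 0 < k) (hη₁ : 0 < η₁) (ℓ : ℕ) {ε : ℝ} (hε : 0 < ε) :
    ∃ N : ℕ, ∀ n ≥ N, ∀ b : ℤ, 0 ≤ b → MarginalsClose ℓ ε (noiseLaw k η₁ η₂ ψ b n)
      (gaussianPlusUniform (noiseCov k η₁ η₂ ψ n) b) := by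
  obtain ⟨N, hN⟩ := Filter.eventually_atTop.1
    (eventually_forall_abs_smoothNoiseLaw_sub_le η₂ hψ hk hη₁ ℓ hε)
  refine ⟨N, fun n hn b hb => ?_⟩
  have := isProbabilityMeasure_discreteUniform hb
  rw [noiseLaw_eq_conv]
  exact marginalsClose_conv (Q := gaussianLaw (noiseCov k η₁ η₂ ψ n))
    (U := Measure.pi fun _ => castLaw (discreteUniform b)) (hN n hn)

end Assembly

end Kyber

theorem theorem1 (k η₁ η₂ : ℕ) (hk : 0 < k) (hη₁ : 0 < η₁) :
    -- a centred rounding noise law: the limiting covariance is `σ_G² I_n`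
    (∀ (ψ : Measure ℤ) [IsProbabilityMeasure ψ], MemLp (fun c : ℤ => (c : ℝ)) 2 ψ →
      ∫ c, (c : ℝ) ∂ψ = 0 →
      (∀ n q dv : ℕ, Kyber.SameMeanCov
        (Kyber.noiseLaw k η₁ η₂ ψ (Kyber.halfWidth q dv) n)
        (Kyber.gaussianPlusUniform (Kyber.sigmaSq k η₁ η₂ ψ n • 1) (Kyber.halfWidth q dv))) ∧
      (∀ (ℓ : ℕ) (ε : ℝ), 0 < ε → ∃ N : ℕ, ∀ n ≥ N, ∀ q dv : ℕ, Kyber.MarginalsClose ℓ ε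
        (Kyber.noiseLaw k η₁ η₂ ψ (Kyber.halfWidth q dv) n)
        (Kyber.gaussianPlusUniform (Kyber.sigmaSq k η₁ η₂ ψ n • 1) (Kyber.halfWidth q dv)))) ∧
    -- the exact rounding noise of Kyber, with the correction due to its mean
    (∀ q du : ℕ, 0 < du → 2 ^ du < q →
      (∀ n dv : ℕ, Kyber.SameMeanCov
        (Kyber.noiseLaw k η₁ η₂ (Kyber.roundingNoise q du) (Kyber.halfWidth q dv) n)
        (Kyber.gaussianPlusUniform
          (Kyber.sigmaSq k η₁ η₂ (Kyber.roundingNoise q du) n • 1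
            + ((k * η₁ : ℝ) / 2 * (∫ c, (c : ℝ) ∂(Kyber.roundingNoise q du)) ^ 2) •
              Kyber.overlap n)
          (Kyber.halfWidth q dv))) ∧
      (∀ (ℓ : ℕ) (ε : ℝ), 0 < ε → ∃ N : ℕ, ∀ n ≥ N, ∀ dv : ℕ, Kyber.MarginalsClose ℓ ε
        (Kyber.noiseLaw k η₁ η₂ (Kyber.roundingNoise q du) (Kyber.halfWidth q dv) n)
        (Kyber.gaussianPlusUniform
          (Kyber.sigmaSq k η₁ η₂ (Kyber.roundingNoise q du) n • 1
            + ((k * η₁ : ℝ) / 2 * (∫ c, (c : ℝ) ∂(Kyber.roundingNoise q du)) ^ 2) •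
              Kyber.overlap n)
          (Kyber.halfWidth q dv)))) := by
  constructor
  · intro ψ _ hψ h0
    -- A vanishing mean removes the overlap term, so both parts of the theorem are instances of the
    -- statements about `noiseCov`.
    have hcov : ∀ n, Kyber.noiseCov k η₁ η₂ ψ n = Kyber.sigmaSq k η₁ η₂ ψ n • 1 := by
      intro n
      simp [Kyber.noiseCov, h0]
    simp only [← hcov]
    refine ⟨fun n q dv => Kyber.sameMeanCov_noiseLaw hψ k η₁ η₂ (Kyber.halfWidth_nonneg q dv) n,
      fun ℓ ε hε => ?_⟩
    obtain ⟨N, hN⟩ := Kyber.exists_forall_marginalsClose_noiseLaw hψ η₂ hk hη₁ ℓ hε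
    exact ⟨N, fun n hn q dv => hN n hn _ (Kyber.halfWidth_nonneg q dv)⟩
  · intro q du _ hq
    have := Kyber.isProbabilityMeasure_roundingNoise (hq.trans_le' (Nat.zero_le _)) du
    have hψ := Kyber.memLp_roundingNoise q du
    -- The displayed covariance matrix is `noiseCov` unfolded.
    refine ⟨fun n dv => Kyber.sameMeanCov_noiseLaw hψ k η₁ η₂ (Kyber.halfWidth_nonneg q dv) n,
      fun ℓ ε hε => ?_⟩
    obtain ⟨N, hN⟩ := Kyber.exists_forall_marginalsClose_noiseLaw hψ η₂ hk hη₁ ℓ hε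
    exact ⟨N, fun n hn dv => hN n hn _ (Kyber.halfWidth_nonneg q dv)⟩
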